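/- Let $\mathcal E$ be a finite-dimensional Euclidean space with inner product "$.$" (adjoints are written $A^{\mathsf t}$), $\mathcal Q\subset\mathcal E$ a smooth embedded submanifold of dimension $d$, $\mathcal B$ a smooth manifold of dimension $m$, and $\mathfrak q:\mathcal Q\to\mathcal B$ a smooth submersion. Let $\Pi$ be a smooth projection function onto $T\mathcal Q$, i.e. a smooth map $\Pi:\mathcal Q\to \mathrm{Lin}(\mathcal E,\mathcal E)$ with $\Pi(q)^2=\Pi(q)$ and $\mathrm{Im}\,\Pi(q)=T_q\mathcal Q$. (1) If $\mathcal Q\neq\emptyset$ then $m\le d$; for every $b\in\mathcal B$ the fiber $\mathfrak q^{-1}(b)$ is an embedded submanifold of dimension $d-m$ (possibly empty); the tangent spaces $\mathcal V_q:=T_q\,\mathfrak q^{-1}(\mathfrak q(q))$ form a smooth subbundle $\mathcal V\subset T\mathcal Q$. Assume now that $\mathcal H$ is a smooth subbundle with $T\mathcal Q=\mathcal H\oplus\mathcal V$, and let $\Pi=\mathsf H+\mathsf V$ be the corresponding decomposition ($\mathsf H(q)e\in\mathcal H_q$, $\mathsf V(q)e\in\mathcal V_q$, $\mathsf H(q)e+\mathsf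 V(q)e=\Pi(q)e$ for $e\in\mathcal E$). Put $\mathcal H^*_q=\mathrm{Im}\,\mathsf H(q)^{\mathsf t}$ and $\mathcal H^*=\{(q,p): q\in\mathcal Q,\ p\in\mathcal H^*_q\}\subset\mathcal E^2$, and let $\Omega(\xi,\eta)=\xi_q.\eta_p-\xi_p.\eta_q$ on $\mathcal E^2$. At $x=(q,p)\in\mathcal H^*$ define the $\mathcal H^*$-vertical vectors $$\mathcal V_x\mathcal H^*=\{(\epsilon,\ -\mathsf H(q)^{\mathsf t}\Phi+\mathsf H'(q;\epsilon)^{\mathsf t}p):\ \epsilon\in\mathcal V_q\},$$ where $\Phi\in\mathcal E$ is any vector with $\Delta.\Phi=\epsilon.\mathsf V'(q;\Delta)^{\mathsf t}p$ for all $\Delta\in T_q\mathcal Q$, and the $\mathcal H^*$-horizontal vectors $$\mathcal H_x\mathcal H^*=\{(\delta_q,\delta_p):\ \delta_q\in\mathcal H_q,\ \delta_p=\mathsf H(q)^{\mathsf t}\delta_p+\mathsf H'(q;\delta_q)^{\mathsf t}p\}\subset T_x\mathcal H^*.$$ (Here $\mathsf H'(q;\cdot),\mathsf V'(q;\cdot)$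 are directional derivatives along $\mathcal Q$.) (2) For $q\in\mathcal Q$, $\mathfrak q'(q)$ maps $\mathcal H_q$ bijectively onto $T_{\mathfrak q(q)}\mathcal B$, and $w\mapsto\mathsf H(q)^{\mathsf t}\mathfrak q'(q)^*w$ is a bijection from $T^*_{\mathfrak q(q)}\mathcal B$ onto $\mathcal H_q^*$. Hence $\mathfrak q_{\mathcal H^*}(q,p):=(\mathfrak q(q),w)$, where $\mathsf H(q)^{\mathsf t}\mathfrak q'(q)^*w=p$, defines a map $\mathfrak q_{\mathcal H^*}:\mathcal H^*\to T^*\mathcal B$. (3) $\mathcal H^*$ is an embedded submanifold of $\mathcal E^2$ of dimension $d+m$, and $\mathfrak q_{\mathcal H^*}$ is a smooth submersion whose image is the part of $T^*\mathcal B$ over $\mathfrak q(\mathcal Q)$ (so it is onto $T^*\mathcal B$ if $\mathfrak q$ is onto $\mathcal B$). It is presymplectic: $\Omega_{\mathcal B}(\mathfrak q_{\mathcal H^*}'(x)\xi,\mathfrak q_{\mathcal H^*}'(x)\eta)=\Omega(\xi,\eta)$ for $x\in\mathcal H^*$, $\xi,\eta\in T_x\mathcal H^*$, where $\Omega_{\mathcal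 B}=-d\theta$ is the canonical symplectic form of $T^*\mathcal B$ ($\theta$ the tautological $1$-form). For every $x\in\mathcal H^*$ the kernel of $\mathfrak q_{\mathcal H^*}'(x)$ on $T_x\mathcal H^*$ is $\mathcal V_x\mathcal H^*$, and $\mathfrak q_{\mathcal H^*}'(x)$ maps $\mathcal H_x\mathcal H^*$ bijectively onto $T_{\mathfrak q_{\mathcal H^*}(x)}T^*\mathcal B$. (4) Let $F:T^*\mathcal B\to\mathbb R$ be smooth and $G=F\circ\mathfrak q_{\mathcal H^*}$. Then $G$ is an $\mathcal H^*$-Hamiltonian, i.e. $G$ is smooth on $\mathcal H^*$ and $dG$ vanishes on $\mathcal H^*$-vertical vectors. There are a unique vector field $\mathsf X_F$ on $T^*\mathcal B$ with $\Omega_{\mathcal B}(\mathsf X_F,\eta)=dF(\eta)$ for all tangent vectors $\eta$, and a unique $\mathcal H^*$-horizontal vector field $\mathsf Z_G$ on $\mathcal H^*$ with $\Omega(\mathsf Z_G,\xi)=dG(\xi)$ for all $\mathcal H^*$-horizontal vectors $\xi$. They satisfy $\mathfrak q_{\mathcal H^*}'(x)\mathsf Z_G(x)=\mathsf X_F(\mathfrak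 q_{\mathcal H^*}(x))$ for $x\in\mathcal H^*$, and $\mathfrak q_{\mathcal H^*}$ maps every solution curve in $\mathcal H^*$ of $\dot\gamma=\mathsf Z_G(\gamma)$ to a solution curve of $\mathsf X_F$. -/

import Mathlib

open scoped Manifold ContDiff Topology InnerProductSpace

noncomputable section

/-! ### Embedded submanifolds of a finite-dimensional real normed space -/

section Submanifold

variable {V : Type*} [NormedAddCommGroup V] [NormedSpace ℝ V]

/-- `S ⊆ V` is a smooth embedded submanifold of dimension `d`: near each of its points it is the
zero set of `dim V - d` smooth functions with linearly independent differentials. -/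
def IsEmbeddedSubmanifold (d : ℕ) (S : Set V) : Prop :=
  ∀ x ∈ S, ∃ (k : ℕ) (U : Set V) (C : V → Fin k → ℝ),
    k + d = Module.finrank ℝ V ∧ IsOpen U ∧ x ∈ U ∧ ContDiffOn ℝ ∞ C U ∧
    S ∩ U = {y ∈ U | C y = 0} ∧
    ∀ y ∈ S ∩ U, Function.Surjective (fderiv ℝ C y)

/-- The tangent space `T_x S`, spanned by the velocities at `x` of curves in `S`
(for an embedded submanifold these velocities already form a linear subspace). -/
def tangentSpaceOf (S : Set V) (x : V) : Submodule ℝ V :=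
  Submodule.span ℝ
    {v | ∃ γ : ℝ → V, γ 0 = x ∧ (∀ᶠ t in 𝓝 (0 : ℝ), γ t ∈ S) ∧ HasDerivAt γ v 0}

/-- The family `W` of subspaces of `V` is a smooth subbundle of the trivial bundle `S × V`:
near each point of `S` it has a smooth frame. -/
def IsSmoothSubbundle (S : Set V) (W : V → Submodule ℝ V) : Prop :=
  ∀ x ∈ S, ∃ (U : Set V) (r : ℕ) (s : Fin r → V → V), IsOpen U ∧ x ∈ U ∧
    (∀ i, ContDiffOn ℝ ∞ (s i) (S ∩ U)) ∧
    ∀ y ∈ S ∩ U, LinearIndependent ℝ (fun i => s i y) ∧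
      Submodule.span ℝ (Set.range fun i => s i y) = W y

/-- The map `f`, restricted to the submanifold `S ⊆ V`, is a smooth submersion into the manifold
`N`: it is smooth on `S` and at each `x ∈ S` its differential maps `T_x S` onto `T_{f x} N`.
(On `T_x S` the differential along `S` is `mfderivWithin _ _ f S x`.) -/
def IsSmoothSubmersionOn {H' F' N : Type*} [NormedAddCommGroup F'] [NormedSpace ℝ F']
    [TopologicalSpace H'] (J : ModelWithCorners ℝ F' H') [TopologicalSpace N] [ChartedSpace H' N]
    (f : V → N) (S : Set V) : Prop :=
  ContMDiffOn 𝓘(ℝ, V) J ∞ f S ∧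
  ∀ x ∈ S, ∀ η : TangentSpace J (f x), ∃ v ∈ tangentSpaceOf S x,
    mfderivWithin 𝓘(ℝ, V) J f S x v = η

end Submanifold

/-! ### The cotangent bundle of a manifold and its symplectic form -/

section Cotangent

/-- The exterior derivative of a `1`-form `α` on a manifold, `dα(v, w) = D_v α(w) - D_w α(v)`
computed in the preferred chart `φ` at `x` for the pulled back form `(φ⁻¹)^* α`. (Tangent vectors at
`x` are, by definition of `TangentSpace`, represented in this chart.) -/
def oneFormExtDeriv {E H M : Type*} [NormedAddCommGroup E] [NormedSpace ℝ E]
    [TopologicalSpace H] (I : ModelWithCorners ℝ E H) [TopologicalSpace M] [ChartedSpace H M]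
    (α : ∀ x : M, TangentSpace I x →L[ℝ] ℝ) (x : M) (v w : TangentSpace I x) : ℝ :=
  let φ := extChartAt I x
  let a : E → E →L[ℝ] ℝ := fun y =>
    (α (φ.symm y)).comp (mfderivWithin 𝓘(ℝ, E) I φ.symm (Set.range I) y)
  (fderivWithin ℝ a (Set.range I) (φ x) v : E →L[ℝ] ℝ) w -
    (fderivWithin ℝ a (Set.range I) (φ x) w : E →L[ℝ] ℝ) v

variable (F B : Type*) [NormedAddCommGroup F] [NormedSpace ℝ F]
  [TopologicalSpace B] [ChartedSpace F B] [IsManifold 𝓘(ℝ, F) ∞ B]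

/-- The cotangent space `T_b^* B`. -/
abbrev CotangentSpace (b : B) : Type _ :=
  TangentSpace 𝓘(ℝ, F) b →L[ℝ] Bundle.Trivial B ℝ b

/-- The cotangent bundle `T^* B`. -/
abbrev CotangentBundle : Type _ :=
  Bundle.TotalSpace (F →L[ℝ] ℝ) (CotangentSpace F B)

/-- The model of the cotangent bundle as a manifold. -/
abbrev cotangentModel : ModelWithCorners ℝ (F × (F →L[ℝ] ℝ)) (ModelProd F (F →L[ℝ] ℝ)) :=
  𝓘(ℝ, F).prod 𝓘(ℝ, F →L[ℝ] ℝ)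

variable {F B}

/-- The tautological `1`-form on `T^* B`: `θ_{(b, w)}(ξ) = w (dπ ξ)`. -/
def tautologicalForm (z : CotangentBundle F B) :
    TangentSpace (cotangentModel F) z →L[ℝ] ℝ :=
  (z.2 : TangentSpace 𝓘(ℝ, F) z.1 →L[ℝ] ℝ).comp
    (mfderiv (cotangentModel F) 𝓘(ℝ, F)
      (Bundle.TotalSpace.proj : CotangentBundle F B → B) z)

/-- The symplectic form `Ω = -dθ` on `T^* B`. -/
def cotangentSymplectic (z : CotangentBundle F B)
    (ξ η : TangentSpace (cotangentModel F) z) : ℝ :=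
  - oneFormExtDeriv (cotangentModel F) tautologicalForm z ξ η

/-- `X` is the value at `z` of the Hamilton vector field `X_K` of `K : T^* B → ℝ`, that is
`Ω(X, η) = dK(η)` for all tangent vectors `η` at `z`. -/
def IsHamiltonVector (K : CotangentBundle F B → ℝ) (z : CotangentBundle F B)
    (X : TangentSpace (cotangentModel F) z) : Prop :=
  ∀ η : TangentSpace (cotangentModel F) z,
    cotangentSymplectic z X η = mfderiv (cotangentModel F) 𝓘(ℝ, ℝ) K z η

end Cotangent

/-! ### Horizontal bundles of embedded manifolds

`Q ⊆ E` is a submanifold, `f : Q → B` a map (its values off `Q` are never used), `PH` and `PV` are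
the operator-valued functions on `Q` that project to the horizontal and the vertical bundle. -/

section Horizontal

open ContinuousLinearMap (adjoint)

variable {E : Type*} [NormedAddCommGroup E] [InnerProductSpace ℝ E] [FiniteDimensional ℝ E]

/-- The vertical space at `q`: the tangent space of the fiber of `f` through `q`. -/
def verticalSpace {B : Type*} (Q : Set E) (f : E → B) (q : E) : Submodule ℝ E :=
  tangentSpaceOf (Q ∩ f ⁻¹' {f q}) q

/-- The fiber `Im (PH(q)ᵗ) ⊆ E` of the dual `ℋ^*` of the horizontal bundle. -/
def horizontalDual (PH : E → E →L[ℝ] E) (q : E) : Submodule ℝ E :=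
  LinearMap.range (adjoint (PH q)).toLinearMap

/-- The total space `ℋ^* ⊆ E × E`. -/
def horizontalDualBundle (Q : Set E) (PH : E → E →L[ℝ] E) : Set (E × E) :=
  {x | x.1 ∈ Q ∧ x.2 ∈ horizontalDual PH x.1}

/-- The Poincaré form of `E × E`, `Ω(ξ, η) = ξ_q . η_p - ξ_p . η_q`. -/
def poincareForm (ξ η : E × E) : ℝ := ⟪ξ.1, η.2⟫_ℝ - ⟪ξ.2, η.1⟫_ℝ

/-- The `ℋ^*`-vertical vectors at `x = (q, p)`: the vectors `(ε, 𝖡(q, p) ε)` with `ε` vertical and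
`𝖡(q, p) ε = - PH(q)ᵗ Φ + PH'(q; ε)ᵗ p`, where `Φ = {X ↦ PV'(q; X)ᵗ p}ᵗ ε` is any vector with
`Δ . Φ = ε . PV'(q; Δ)ᵗ p` for all `Δ ∈ T_q Q`. -/
def dualVertical {B : Type*} (Q : Set E) (f : E → B) (PH PV : E → E →L[ℝ] E) (x : E × E) :
    Set (E × E) :=
  {ξ | ξ.1 ∈ verticalSpace Q f x.1 ∧ ∃ Φ : E,
    (∀ Δ ∈ tangentSpaceOf Q x.1,
      ⟪Δ, Φ⟫_ℝ = ⟪ξ.1, adjoint (fderivWithin ℝ PV Q x.1 Δ) x.2⟫_ℝ) ∧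
    ξ.2 = - adjoint (PH x.1) Φ + adjoint (fderivWithin ℝ PH Q x.1 ξ.1) x.2}

/-- The `ℋ^*`-horizontal vectors at `x = (q, p)`: the vectors `(δ_q, δ_p)` with `δ_q` horizontal and
`δ_p = PH(q)ᵗ δ_p + PH'(q; δ_q)ᵗ p`. -/
def dualHorizontal (Q : Set E) (Hor : E → Submodule ℝ E) (PH : E → E →L[ℝ] E) (x : E × E) :
    Set (E × E) :=
  {ξ | ξ.1 ∈ Hor x.1 ∧
    ξ.2 = adjoint (PH x.1) ξ.2 + adjoint (fderivWithin ℝ PH Q x.1 ξ.1) x.2}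

/-- `G` is an `ℋ^*`-Hamiltonian: a smooth function on `ℋ^*` whose differential vanishes on
`ℋ^*`-vertical vectors. -/
def IsDualHamiltonian {B : Type*} (Q : Set E) (f : E → B) (PH PV : E → E →L[ℝ] E)
    (G : E × E → ℝ) : Prop :=
  ContDiffOn ℝ ∞ G (horizontalDualBundle Q PH) ∧
  ∀ x ∈ horizontalDualBundle Q PH, ∀ ξ ∈ dualVertical Q f PH PV x,
    fderivWithin ℝ G (horizontalDualBundle Q PH) x ξ = 0

/-- `ζ` is the value at `x` of the `ℋ^*`-Hamilton vector field `Z_G` of `G`: it is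
`ℋ^*`-horizontal and `Ω(ζ, ξ) = dG(ξ)` for all `ℋ^*`-horizontal `ξ`. -/
def IsDualHamiltonVector (Q : Set E) (Hor : E → Submodule ℝ E) (PH : E → E →L[ℝ] E)
    (G : E × E → ℝ) (x ζ : E × E) : Prop :=
  ζ ∈ dualHorizontal Q Hor PH x ∧
  ∀ ξ ∈ dualHorizontal Q Hor PH x,
    poincareForm ζ ξ = fderivWithin ℝ G (horizontalDualBundle Q PH) x ξ

variable {F B : Type*} [NormedAddCommGroup F] [NormedSpace ℝ F]
  [TopologicalSpace B] [ChartedSpace F B] [IsManifold 𝓘(ℝ, F) ∞ B]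

/-- The differential `f'(q)` along `Q`, meaningful on `T_q Q`. -/
def diffAlong (Q : Set E) (f : E → B) (q : E) : E →L[ℝ] TangentSpace 𝓘(ℝ, F) (f q) :=
  mfderivWithin 𝓘(ℝ, E) 𝓘(ℝ, F) f Q q

/-- The map `w ↦ PH(q)ᵗ f'(q)^* w` from `T_{f q}^* B` to `E`. -/
def horizontalPullback (Q : Set E) (f : E → B) (PH : E → E →L[ℝ] E) (q : E)
    (w : CotangentSpace F B (f q)) : E :=
  adjoint (PH q) ((InnerProductSpace.toDual ℝ E).symm (w.comp (diffAlong Q f q)))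

/-- The induced map `f_{ℋ^*} : ℋ^* → T^* B`, `(q, p) ↦ (f q, w)` where `w` is the solution of
`PH(q)ᵗ f'(q)^* w = p`. -/
def dualSubmersion (Q : Set E) (f : E → B) (PH : E → E →L[ℝ] E) (x : E × E) :
    CotangentBundle F B :=
  ⟨f x.1, Function.invFun (horizontalPullback Q f PH x.1) x.2⟩

/-- The differential of `f_{ℋ^*}` along `ℋ^*`, meaningful on `T_x ℋ^*`. -/
def dualSubmersionDiff (Q : Set E) (f : E → B) (PH : E → E →L[ℝ] E) (x : E × E) :
    E × E →L[ℝ] TangentSpace (cotangentModel F) (dualSubmersion (F := F) Q f PH x) :=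
  mfderivWithin 𝓘(ℝ, E × E) (cotangentModel F) (dualSubmersion (F := F) Q f PH)
    (horizontalDualBundle Q PH) x

end Horizontal

end

/-!
Every assertion is reduced to calculus on open sets by smooth local retractions. By the inverse
function theorem, a set is an embedded submanifold exactly when near each of its points it is the
image of a smooth map `ρ = ρ ∘ ρ` of constant rank, defined on an open set
(`exists_isSmoothRetraction_of_regular`, `isEmbeddedSubmanifold_of_isSmoothRetraction`). Then the
tangent space at `y` is the fixed space of `Dρ(y)`, a smooth map on the submanifold extends to an
open set by composing it with `ρ`, and, although derivatives within a submanifold are not unique,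
their values on tangent vectors are those of the extension
(`IsSmoothRetraction.hasFDerivWithinAt_apply`).

For `Q`, let `g` be `f ∘ ρ` read in a chart of `B`. The fibers of `f` are cut out of `Q` by `g`, so
that the vertical space is the kernel of `f'(q)` on the tangent space, and explicit formulas in
terms of `Dg` and `Dρ` show that the vertical bundle and the projection `PH` are smooth. A
retraction onto the dual bundle is `(q, p) ↦ (ρ q, PH(ρ q)ᵗ p)`, which gives its dimension and its
tangent space.

In a chart of the cotangent bundle the tautological form is `(u, w) ↦ w ∘ du`, so the symplectic
form is the standard one (`cotangentSymplectic_apply`). The covector component `σ` of the induced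
map `f_{ℋ^*}` is characterized by `σ(q, p)(Dg(q) a) = p . a` for `a` tangent to `Q`, that is,
`f_{ℋ^*}` pulls the tautological form back to `p . dq`. Differentiating this identity, with the
symmetry of the second derivatives of `g` and `ρ`, shows that `f_{ℋ^*}` is presymplectic
(`IsHorizontalSplitting.cotangentSymplectic_dualSubmersionDiff`). That the kernel of its
differential consists of the `ℋ^*`-vertical vectors, and that it is bijective on the
`ℋ^*`-horizontal ones, is then linear algebra with the derivatives of the identities
`PH² = PH`, `P² = P` and `PH + PV = P`. Finally, a horizontal vector is the Hamilton vector of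
`K ∘ f_{ℋ^*}` exactly when its image is the Hamilton vector of `K`
(`IsHorizontalSplitting.isDualHamiltonVector_iff`), and the chain rule transports solution curves.
-/

noncomputable section

/-! ### Smooth local retractions onto submanifolds -/

section Retraction

variable {V W : Type*} [NormedAddCommGroup V] [NormedSpace ℝ V]
  [NormedAddCommGroup W] [NormedSpace ℝ W]

/-- `ρ` is a smooth retraction of the open set `U` onto `S ∩ U`. -/
structure IsSmoothRetraction (S U : Set V) (ρ : V → V) : Prop where
  isOpen : IsOpen U
  contDiffOn : ContDiffOn ℝ ∞ ρ U
  mapsTo : Set.MapsTo ρ U (S ∩ U)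
  eq_self : ∀ y ∈ S ∩ U, ρ y = y

theorem exists_isSmoothRetraction_of_mapsTo {S U : Set V} {ρ : V → V} (hU : IsOpen U)
    (hρ : ContDiffOn ℝ ∞ ρ U) (hm : Set.MapsTo ρ U S) (he : ∀ y ∈ S ∩ U, ρ y = y) {x : V}
    (hx : x ∈ S ∩ U) : ∃ U' ⊆ U, x ∈ U' ∧ IsSmoothRetraction S U' ρ := by
  refine ⟨U ∩ ρ ⁻¹' U, Set.inter_subset_left, ⟨hx.2, ?_⟩, ?_, ?_, ?_, ?_⟩
  · rw [Set.mem_preimage, he x hx]; exact hx.2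
  · exact hρ.continuousOn.isOpen_inter_preimage hU hU
  · exact hρ.mono Set.inter_subset_left
  · intro y hy
    refine ⟨hm hy.1, hy.2, ?_⟩
    rw [Set.mem_preimage, he (ρ y) ⟨hm hy.1, hy.2⟩]; exact hy.2
  · exact fun y hy => he y ⟨hy.1, hy.2.1⟩

namespace IsSmoothRetraction

variable {S U : Set V} {ρ : V → V}

theorem exists_restrict (h : IsSmoothRetraction S U ρ) {O : Set V} (hO : IsOpen O) {x : V}
    (hx : x ∈ S ∩ U) (hxO : x ∈ O) : ∃ U' ⊆ U ∩ O, x ∈ U' ∧ IsSmoothRetraction S U' ρ :=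
  exists_isSmoothRetraction_of_mapsTo (h.isOpen.inter hO)
    (h.contDiffOn.mono Set.inter_subset_left) (fun _ hy => (h.mapsTo hy.1).1)
    (fun y hy => h.eq_self y ⟨hy.1, hy.2.1⟩) ⟨hx.1, hx.2, hxO⟩

theorem idem (h : IsSmoothRetraction S U ρ) {y : V} (hy : y ∈ U) : ρ (ρ y) = ρ y :=
  h.eq_self _ (h.mapsTo hy)

theorem hasFDerivAt (h : IsSmoothRetraction S U ρ) {y : V} (hy : y ∈ U) :
    HasFDerivAt ρ (fderiv ℝ ρ y) y :=
  ((h.contDiffOn.contDiffAt (h.isOpen.mem_nhds hy)).differentiableAt (by simp)).hasFDerivAt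

theorem fderiv_comp_fderiv (h : IsSmoothRetraction S U ρ) {y : V} (hy : y ∈ U) (v : V) :
    fderiv ℝ ρ (ρ y) (fderiv ℝ ρ y v) = fderiv ℝ ρ y v := by
  have h1 := h.hasFDerivAt hy
  have h2 := (h.hasFDerivAt (h.mapsTo hy).2).comp y h1
  have h3 : ρ ∘ ρ =ᶠ[𝓝 y] ρ := by
    filter_upwards [h.isOpen.mem_nhds hy] with z hz using h.idem hz
  exact DFunLike.congr_fun ((h2.congr_of_eventuallyEq h3.symm).unique h1) v

theorem fderiv_idem (h : IsSmoothRetraction S U ρ) {y : V} (hy : y ∈ S ∩ U) (v : V) :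
    fderiv ℝ ρ y (fderiv ℝ ρ y v) = fderiv ℝ ρ y v := by
  have := h.fderiv_comp_fderiv hy.2 v
  rwa [h.eq_self y hy] at this

theorem mem_tangentSpaceOf_iff (h : IsSmoothRetraction S U ρ) {y : V} (hy : y ∈ S ∩ U) {v : V} :
    v ∈ tangentSpaceOf S y ↔ fderiv ℝ ρ y v = v := by
  constructor
  · intro hv
    suffices tangentSpaceOf S y ≤ LinearMap.eqLocus (fderiv ℝ ρ y).toLinearMap LinearMap.id from
      this hv
    refine Submodule.span_le.2 ?_
    rintro w ⟨γ, h0, hS, hγ⟩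
    have h1 : HasFDerivAt ρ (fderiv ℝ ρ y) (γ 0) := by rw [h0]; exact h.hasFDerivAt hy.2
    have h2 := h1.comp_hasDerivAt (0 : ℝ) hγ
    have hU : ∀ᶠ t in 𝓝 (0 : ℝ), γ t ∈ U :=
      hγ.continuousAt.preimage_mem_nhds (by rw [h0]; exact h.isOpen.mem_nhds hy.2)
    have h3 : ρ ∘ γ =ᶠ[𝓝 0] γ := by
      filter_upwards [hS, hU] with t ht ht' using h.eq_self _ ⟨ht, ht'⟩
    exact (h2.congr_of_eventuallyEq h3.symm).unique hγ
  · intro hv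
    refine Submodule.subset_span ⟨fun t => ρ (y + t • v), by simp [h.eq_self y hy], ?_, ?_⟩
    · have : Filter.Tendsto (fun t : ℝ => y + t • v) (𝓝 0) (𝓝 y) := by
        have : Continuous (fun t : ℝ => y + t • v) := by fun_prop
        simpa using this.tendsto 0
      filter_upwards [this (h.isOpen.mem_nhds hy.2)] with t ht using (h.mapsTo ht).1
    · have h1 : HasDerivAt (fun t : ℝ => y + t • v) v 0 := by
        simpa using ((hasDerivAt_id (0 : ℝ)).smul_const v).const_add y
      have h2 : HasFDerivAt ρ (fderiv ℝ ρ y) (y + (0 : ℝ) • v) := by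
        simpa using h.hasFDerivAt hy.2
      have := h2.comp_hasDerivAt (0 : ℝ) h1
      rwa [hv] at this

theorem fderiv_mem (h : IsSmoothRetraction S U ρ) {y : V} (hy : y ∈ S ∩ U) (v : V) :
    fderiv ℝ ρ y v ∈ tangentSpaceOf S y :=
  (h.mem_tangentSpaceOf_iff hy).2 (h.fderiv_idem hy v)

theorem fderiv_mem_of_mem (h : IsSmoothRetraction S U ρ) {y : V} (hy : y ∈ U) (v : V) :
    fderiv ℝ ρ y v ∈ tangentSpaceOf S (ρ y) :=
  (h.mem_tangentSpaceOf_iff (h.mapsTo hy)).2 (h.fderiv_comp_fderiv hy v)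

theorem range_fderiv (h : IsSmoothRetraction S U ρ) {y : V} (hy : y ∈ S ∩ U) :
    LinearMap.range (fderiv ℝ ρ y).toLinearMap = tangentSpaceOf S y := by
  ext v
  constructor
  · rintro ⟨w, rfl⟩; exact h.fderiv_mem hy w
  · intro hv; exact ⟨v, (h.mem_tangentSpaceOf_iff hy).1 hv⟩

theorem contDiffOn_comp (h : IsSmoothRetraction S U ρ) {g : V → W} (hg : ContDiffOn ℝ ∞ g S) :
    ContDiffOn ℝ ∞ (g ∘ ρ) U :=
  hg.comp h.contDiffOn fun _ hy => (h.mapsTo hy).1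

/-- Derivatives within `S` are determined on tangent vectors. -/
theorem hasFDerivWithinAt_apply (h : IsSmoothRetraction S U ρ) {y : V} (hy : y ∈ S ∩ U)
    {g : V → W} {g' : V →L[ℝ] W} (hg : HasFDerivWithinAt g g' S y) {v : V}
    (hv : v ∈ tangentSpaceOf S y) : g' v = fderiv ℝ (g ∘ ρ) y v := by
  have h1 : HasFDerivWithinAt g g' S (ρ y) := by rw [h.eq_self y hy]; exact hg
  have h2 : HasFDerivAt (g ∘ ρ) (g'.comp (fderiv ℝ ρ y)) y :=
    h1.comp_hasFDerivAt y (h.hasFDerivAt hy.2) (by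
      filter_upwards [h.isOpen.mem_nhds hy.2] with z hz using (h.mapsTo hz).1)
  rw [h2.fderiv, ContinuousLinearMap.comp_apply, (h.mem_tangentSpaceOf_iff hy).1 hv]

end IsSmoothRetraction

/-- The inverse function theorem, with a smooth inverse on the whole target. -/
theorem exists_openPartialHomeomorph_contDiffOn_symm [CompleteSpace V] {Ψ : V → W} {U : Set V}
    (hU : IsOpen U) (hΨ : ContDiffOn ℝ ∞ Ψ U) {x : V} (hx : x ∈ U) (e : V ≃L[ℝ] W)
    (he : fderiv ℝ Ψ x = e) :
    ∃ φ : OpenPartialHomeomorph V W, (φ : V → W) = Ψ ∧ x ∈ φ.source ∧ φ.source ⊆ U ∧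
      ContDiffOn ℝ ∞ φ.symm φ.target := by
  have hd : ∀ y ∈ U, HasFDerivAt Ψ (fderiv ℝ Ψ y) y := fun y hy =>
    ((hΨ.contDiffAt (hU.mem_nhds hy)).differentiableAt (by simp)).hasFDerivAt
  have hc : ContDiffAt ℝ ∞ Ψ x := hΨ.contDiffAt (hU.mem_nhds hx)
  have hx' : HasFDerivAt Ψ (e : V →L[ℝ] W) x := he ▸ hd x hx
  let φ₀ := hc.toOpenPartialHomeomorph Ψ hx' (by simp)
  have hφ₀ : (φ₀ : V → W) = Ψ := rfl
  let O : Set V := U ∩ fderiv ℝ Ψ ⁻¹' Set.range ContinuousLinearEquiv.toContinuousLinearMap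
  have hO : IsOpen O := (hΨ.continuousOn_fderiv_of_isOpen hU (by simp)).isOpen_inter_preimage hU
    ContinuousLinearEquiv.isOpen
  refine ⟨φ₀.restrOpen O hO, rfl, ?_, ?_, ?_⟩
  · rw [φ₀.restrOpen_source]
    exact ⟨hc.mem_toOpenPartialHomeomorph_source hx' (by simp), hx, e, he.symm⟩
  · rw [φ₀.restrOpen_source]
    exact fun y hy => hy.2.1
  · intro w hw
    have hs := (φ₀.restrOpen O hO).map_target hw
    rw [φ₀.restrOpen_source] at hs
    obtain ⟨hsU, e', he'⟩ := hs.2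
    refine ((φ₀.restrOpen O hO).contDiffAt_symm (f₀' := e') hw ?_ ?_).contDiffWithinAt
    · rw [he']; exact hd _ hsU
    · exact hΨ.contDiffAt (hU.mem_nhds hsU)

/-- The zero set of a map `C` is, near a regular point `x`, a smooth retract, and its tangent
space at `x` is the kernel of the differential. -/
theorem exists_isSmoothRetraction_of_regular [FiniteDimensional ℝ V] [FiniteDimensional ℝ W]
    {S U : Set V} {C : V → W} (hU : IsOpen U) (hC : ContDiffOn ℝ ∞ C U)
    (hS : S ∩ U = {y ∈ U | C y = 0}) {x : V} (hx : x ∈ S ∩ U)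
    (hsurj : Function.Surjective (fderiv ℝ C x)) :
    ∃ U' ρ, x ∈ U' ∧ U' ⊆ U ∧ IsSmoothRetraction S U' ρ ∧
      tangentSpaceOf S x = LinearMap.ker (fderiv ℝ C x).toLinearMap := by
  set K := LinearMap.ker (fderiv ℝ C x).toLinearMap with hK
  have hmem : ∀ {v}, v ∈ K ↔ fderiv ℝ C x v = 0 := fun {v} => LinearMap.mem_ker
  obtain ⟨T₀, hT₀⟩ := K.subtype.exists_leftInverse_of_injective K.ker_subtype
  let T : V →L[ℝ] K := T₀.toContinuousLinearMap
  have hT : ∀ k : K, T k = k := fun k => DFunLike.congr_fun hT₀ k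
  let L : V →L[ℝ] W × K := (fderiv ℝ C x).prod T
  have hL : Function.Bijective L := by
    constructor
    · refine (injective_iff_map_eq_zero L).2 fun v hv => ?_
      have h1 : fderiv ℝ C x v = 0 := congrArg Prod.fst hv
      have h2 : T v = 0 := congrArg Prod.snd hv
      have h3 := hT ⟨v, hmem.2 h1⟩
      rw [h2] at h3
      exact (congrArg Subtype.val h3).symm
    · rintro ⟨w, k⟩
      obtain ⟨v, rfl⟩ := hsurj w
      refine ⟨v + (k - T v : K), Prod.ext ?_ ?_⟩
      · have := hmem.1 (k - T v : K).2
        change fderiv ℝ C x (v + (k - T v : K)) = _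
        rw [map_add, this, add_zero]
      · change T (v + (k - T v : K)) = k
        rw [map_add, hT]; abel
  let e : V ≃L[ℝ] W × K := (LinearEquiv.ofBijective L.toLinearMap hL).toContinuousLinearEquiv
  have hCx : HasFDerivAt C (fderiv ℝ C x) x :=
    ((hC.contDiffAt (hU.mem_nhds hx.2)).differentiableAt (by simp)).hasFDerivAt
  obtain ⟨φ, hφ, hxφ, hφU, hsymm⟩ := exists_openPartialHomeomorph_contDiffOn_symm hU
    (Ψ := fun y => (C y, T y)) (hC.prodMk T.contDiff.contDiffOn) hx.2 e
    (by rw [(hCx.prodMk T.hasFDerivAt).fderiv]; ext1 v; rfl)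
  have hφ' : ∀ y, φ y = (C y, T y) := fun y => congrFun hφ y
  have hCx0 : C x = 0 := by rw [hS] at hx; exact hx.2
  let ι : V → W × K := fun y => (0, T y)
  have hι : ContDiff ℝ ∞ ι := contDiff_const.prodMk T.contDiff
  let O : Set V := φ.source ∩ ι ⁻¹' φ.target
  have hO : IsOpen O := φ.open_source.inter (φ.open_target.preimage hι.continuous)
  have hxO : x ∈ O := by
    refine ⟨hxφ, ?_⟩
    have := φ.map_source hxφ
    rwa [hφ', hCx0] at this
  let ρ : V → V := fun y => φ.symm (ι y)
  have hΨρ : ∀ y ∈ O, C (ρ y) = 0 ∧ T (ρ y) = T y := by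
    intro y hy
    have := φ.right_inv hy.2
    rw [hφ'] at this
    exact ⟨congrArg Prod.fst this, congrArg Prod.snd this⟩
  have hρ : ContDiffOn ℝ ∞ ρ O := hsymm.comp hι.contDiffOn fun y hy => hy.2
  have hmaps : Set.MapsTo ρ O S := by
    intro y hy
    have : ρ y ∈ S ∩ U := by
      rw [hS]; exact ⟨hφU (φ.map_target hy.2), (hΨρ y hy).1⟩
    exact this.1
  have hid : ∀ y ∈ S ∩ O, ρ y = y := by
    intro y hy
    have hy' : y ∈ S ∩ U := ⟨hy.1, hφU hy.2.1⟩
    rw [hS] at hy'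
    have := φ.left_inv hy.2.1
    rwa [hφ', hy'.2] at this
  obtain ⟨U', hU'O, hxU', hret⟩ := exists_isSmoothRetraction_of_mapsTo hO hρ hmaps hid ⟨hx.1, hxO⟩
  refine ⟨U', ρ, hxU', fun y hy => hφU (hU'O hy).1, hret, ?_⟩
  have hxS : x ∈ S ∩ U' := ⟨hx.1, hxU'⟩
  have hρx := hret.hasFDerivAt hxU'
  have hC' : HasFDerivAt C (fderiv ℝ C x) (ρ x) := by rwa [hret.eq_self x hxS]
  have key : ∀ v, fderiv ℝ C x (fderiv ℝ ρ x v) = 0 := by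
    intro v
    have h1 := hC'.comp x hρx
    have h2 : C ∘ ρ =ᶠ[𝓝 x] fun _ => 0 := by
      filter_upwards [hO.mem_nhds hxO] with y hy using (hΨρ y hy).1
    exact DFunLike.congr_fun ((h1.congr_of_eventuallyEq h2.symm).unique (hasFDerivAt_const 0 x)) v
  have keyT : ∀ v, T (fderiv ℝ ρ x v) = T v := by
    intro v
    have h1 := T.hasFDerivAt.comp x hρx
    have h2 : T ∘ ρ =ᶠ[𝓝 x] T := by
      filter_upwards [hO.mem_nhds hxO] with y hy using (hΨρ y hy).2
    exact DFunLike.congr_fun ((h1.congr_of_eventuallyEq h2.symm).unique T.hasFDerivAt) v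
  ext v
  rw [hret.mem_tangentSpaceOf_iff hxS, hmem]
  constructor
  · intro h; rw [← h]; exact key v
  · intro h
    have h1 := hT ⟨v, hmem.2 h⟩
    have h2 := hT ⟨_, hmem.2 (key v)⟩
    rw [keyT, h1] at h2
    exact (congrArg Subtype.val h2).symm

/-- Near each of its points, an embedded submanifold is a smooth retract. -/
theorem IsEmbeddedSubmanifold.exists_isSmoothRetraction [FiniteDimensional ℝ V] {d : ℕ} {S : Set V}
    (hS : IsEmbeddedSubmanifold d S) {x : V} (hx : x ∈ S) :
    (∃ U ρ, x ∈ U ∧ IsSmoothRetraction S U ρ) ∧ Module.finrank ℝ (tangentSpaceOf S x) = d := by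
  obtain ⟨k, U, C, hk, hU, hxU, hC, hSU, hsurj⟩ := hS x hx
  obtain ⟨U', ρ, hxU', -, hρ, hT⟩ :=
    exists_isSmoothRetraction_of_regular hU hC hSU ⟨hx, hxU⟩ (hsurj x ⟨hx, hxU⟩)
  refine ⟨⟨U', ρ, hxU', hρ⟩, ?_⟩
  rw [hT]
  have h1 := (fderiv ℝ C x).toLinearMap.finrank_range_add_finrank_ker
  have h2 : LinearMap.range (fderiv ℝ C x).toLinearMap = ⊤ :=
    LinearMap.range_eq_top.2 (hsurj x ⟨hx, hxU⟩)
  rw [h2, finrank_top, Module.finrank_fin_fun] at h1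
  omega

/-- A set that is a smooth retract near each of its points, with tangent spaces of dimension `d`,
is an embedded submanifold: with `D = Dρ(x)`, the map `y ↦ (1 - D)(y - ρ(y))` into `range (1 - D)`
is a local equation. -/
theorem isEmbeddedSubmanifold_of_isSmoothRetraction [FiniteDimensional ℝ V] {d : ℕ} {S : Set V}
    (h : ∀ x ∈ S, ∃ U ρ, x ∈ U ∧ IsSmoothRetraction S U ρ ∧
      Module.finrank ℝ (tangentSpaceOf S x) = d) : IsEmbeddedSubmanifold d S := by
  intro x hx
  obtain ⟨U, ρ, hxU, hρ, hd⟩ := h x hx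
  have hxS : x ∈ S ∩ U := ⟨hx, hxU⟩
  set D := fderiv ℝ ρ x with hDdef
  have hD : ∀ v, D (D v) = D v := hρ.fderiv_idem hxS
  let N : Submodule ℝ V := LinearMap.ker D.toLinearMap
  have hN : Module.finrank ℝ N + d = Module.finrank ℝ V := by
    have := D.toLinearMap.finrank_range_add_finrank_ker
    rw [hρ.range_fderiv hxS, hd] at this
    change d + Module.finrank ℝ N = _ at this
    omega
  let Q₀ : V →L[ℝ] N := (ContinuousLinearMap.id ℝ V - D).codRestrict N fun v => by
    change D (v - D v) = 0
    rw [map_sub, hD, sub_self]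
  have hQ₀ : ∀ v, (Q₀ v : V) = v - D v := fun v => rfl
  let b : N ≃L[ℝ] (Fin (Module.finrank ℝ N) → ℝ) := (Module.finBasis ℝ N).equivFunL
  let Q : V →L[ℝ] (Fin (Module.finrank ℝ N) → ℝ) := (b : N →L[ℝ] _).comp Q₀
  have hQ : Function.Surjective Q := by
    refine b.surjective.comp fun n => ⟨n, Subtype.ext ?_⟩
    have : D n = 0 := n.2
    exact (hQ₀ n).trans (by rw [this, sub_zero])
  have hQ0 : ∀ v, Q v = 0 ↔ v - D v = 0 := by
    intro v
    change b (Q₀ v) = 0 ↔ _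
    rw [map_eq_zero_iff b b.injective, ← hQ₀, Submodule.coe_eq_zero]
  let C : V → (Fin (Module.finrank ℝ N) → ℝ) := fun y => Q (y - ρ y)
  have hC : ContDiffOn ℝ ∞ C U := Q.contDiff.comp_contDiffOn (contDiffOn_id.sub hρ.contDiffOn)
  have hC' : ∀ y ∈ U, HasFDerivAt C (Q.comp (ContinuousLinearMap.id ℝ V - fderiv ℝ ρ y)) y :=
    fun y hy => Q.hasFDerivAt.comp y ((hasFDerivAt_id y).sub (hρ.hasFDerivAt hy))
  let Ψ : V → V := fun y => D (ρ y) + ((y - ρ y) - D (y - ρ y))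
  have hΨ : ContDiffOn ℝ ∞ Ψ U :=
    (D.contDiff.comp_contDiffOn hρ.contDiffOn).add ((contDiffOn_id.sub hρ.contDiffOn).sub
      (D.contDiff.comp_contDiffOn (contDiffOn_id.sub hρ.contDiffOn)))
  have hΨ' : fderiv ℝ Ψ x = (ContinuousLinearEquiv.refl ℝ V : V →L[ℝ] V) := by
    have h1 := hρ.hasFDerivAt hxU
    have h2 := (hasFDerivAt_id x).sub h1
    have h3 := (D.hasFDerivAt.comp x h1).add (h2.sub (D.hasFDerivAt.comp x h2))
    refine h3.fderiv.trans ?_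
    ext v
    simp [← hDdef, hD]
  obtain ⟨φ, hφ, hxφ, hφU, -⟩ := exists_openPartialHomeomorph_contDiffOn_symm hρ.isOpen hΨ hxU _ hΨ'
  -- On `O`, injectivity of `Ψ` separates `y` from `ρ y`.
  let O : Set V := φ.source ∩ ρ ⁻¹' φ.source
  have hO : IsOpen O :=
    (hρ.contDiffOn.continuousOn.mono hφU).isOpen_inter_preimage φ.open_source φ.open_source
  have hxO : x ∈ O := ⟨hxφ, by rw [Set.mem_preimage, hρ.eq_self x hxS]; exact hxφ⟩
  -- On `O'`, the differential of `C` stays surjective.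
  obtain ⟨R, hR⟩ := Q.toLinearMap.exists_rightInverse_of_surjective (LinearMap.range_eq_top.2 hQ)
  let R' : (Fin (Module.finrank ℝ N) → ℝ) →L[ℝ] V := R.toContinuousLinearMap
  have hR' : ∀ c, Q (R' c) = c := fun c => DFunLike.congr_fun hR c
  let M : V → (Fin (Module.finrank ℝ N) → ℝ) →L[ℝ] (Fin (Module.finrank ℝ N) → ℝ) :=
    fun y => (fderiv ℝ C y).comp R'
  have hM : ContinuousOn M U :=
    (hC.continuousOn_fderiv_of_isOpen hρ.isOpen (by simp)).clm_comp continuousOn_const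
  have hCQ : fderiv ℝ C x = Q := by
    rw [(hC' x hxU).fderiv]
    ext1 v
    have : Q (D v) = 0 := by rw [hQ0, hD, sub_self]
    simp [← hDdef, this]
  let O' : Set V := U ∩ M ⁻¹' Set.range ContinuousLinearEquiv.toContinuousLinearMap
  have hO' : IsOpen O' := hM.isOpen_inter_preimage hρ.isOpen ContinuousLinearEquiv.isOpen
  have hxO' : x ∈ O' := by
    refine ⟨hxU, ContinuousLinearEquiv.refl ℝ _, ?_⟩
    ext1 c
    simp [M, hCQ, hR']
  refine ⟨Module.finrank ℝ N, O ∩ O', C, hN, hO.inter hO', ⟨hxO, hxO'⟩,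
    hC.mono fun y hy => hy.2.1, ?_, ?_⟩
  · ext y
    constructor
    · rintro ⟨hyS, hy⟩
      refine ⟨hy, ?_⟩
      change Q (y - ρ y) = 0
      rw [hρ.eq_self y ⟨hyS, hy.2.1⟩, sub_self, map_zero]
    · rintro ⟨hy, hCy⟩
      refine ⟨?_, hy⟩
      have h1 : Ψ y = Ψ (ρ y) := by
        have h2 := (hQ0 _).1 hCy
        change D (ρ y) + ((y - ρ y) - D (y - ρ y)) =
          D (ρ (ρ y)) + ((ρ y - ρ (ρ y)) - D (ρ y - ρ (ρ y)))
        rw [h2, hρ.idem hy.2.1]; simp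
      have h3 : y = ρ y := φ.injOn hy.1.1 hy.1.2 (by rw [hφ]; exact h1)
      rw [h3]; exact (hρ.mapsTo hy.2.1).1
  · rintro y ⟨-, hy⟩ c
    obtain ⟨e, he⟩ := hy.2.2
    refine ⟨R' (e.symm c), ?_⟩
    have : M y (e.symm c) = c := by rw [← he]; simp
    exact this

end Retraction

/-! ### The cotangent bundle in a chart -/

section CotangentChart

variable {F B : Type*} [NormedAddCommGroup F] [NormedSpace ℝ F]
  [TopologicalSpace B] [ChartedSpace F B] [IsManifold 𝓘(ℝ, F) ∞ B]

/-- The differential at `b` of the inverse of the preferred chart at `b₀`, as a map from the model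
space to the tangent space at `b`. -/
abbrev chartFrame (b₀ b : B) : F →L[ℝ] TangentSpace 𝓘(ℝ, F) b :=
  Bundle.Trivialization.symmL ℝ (trivializationAt F (TangentSpace 𝓘(ℝ, F)) b₀) b

theorem trivializationAt_cotangent_apply (b₀ : B) (z : CotangentBundle F B) :
    trivializationAt (F →L[ℝ] ℝ) (CotangentSpace F B) b₀ z =
      (z.1, (z.2 : TangentSpace 𝓘(ℝ, F) z.1 →L[ℝ] ℝ).comp (chartFrame b₀ z.1)) := by
  rw [hom_trivializationAt_apply]
  refine Prod.ext rfl ?_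
  simp [ContinuousLinearMap.inCoordinates]

theorem extChartAt_cotangent_apply (z₀ z : CotangentBundle F B) :
    extChartAt (cotangentModel F) z₀ z = (extChartAt 𝓘(ℝ, F) z₀.1 z.1,
      (z.2 : TangentSpace 𝓘(ℝ, F) z.1 →L[ℝ] ℝ).comp (chartFrame z₀.1 z.1)) := by
  rw [FiberBundle.extChartAt]
  exact congrArg (fun y : B × (F →L[ℝ] ℝ) => (extChartAt 𝓘(ℝ, F) z₀.1 y.1, y.2))
    (trivializationAt_cotangent_apply z₀.1 z)

/-- In a chart of the cotangent bundle, the tautological form is `(u, ω) ↦ ω ∘ du`. -/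
theorem tautologicalForm_comp_mfderivWithin_extChartAt_symm (z₀ : CotangentBundle F B)
    {y : F × (F →L[ℝ] ℝ)} (hy : y ∈ (extChartAt (cotangentModel F) z₀).target) :
    (tautologicalForm ((extChartAt (cotangentModel F) z₀).symm y)).comp
      (mfderivWithin 𝓘(ℝ, F × (F →L[ℝ] ℝ)) (cotangentModel F) (extChartAt (cotangentModel F) z₀).symm
        (Set.range (cotangentModel F)) y) =
      y.2.comp (ContinuousLinearMap.fst ℝ F (F →L[ℝ] ℝ)) := by
  set φ := extChartAt (cotangentModel F) z₀ with hφ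
  set χ := extChartAt 𝓘(ℝ, F) z₀.1 with hχ
  have hopen : IsOpen φ.target := isOpen_extChartAt_target z₀
  have hbase : ∀ y ∈ φ.target, (φ.symm y).1 ∈ χ.source ∧ (φ.symm y).1 = χ.symm y.1 ∧
      y.1 ∈ χ.target := by
    intro y hy
    have h1 := φ.map_target hy
    have h2 := φ.right_inv hy
    rw [hφ, extChartAt_cotangent_apply] at h2
    have h3 : χ (φ.symm y).1 = y.1 := congrArg Prod.fst h2
    have h4 : (φ.symm y).1 ∈ χ.source := by
      rw [hφ, FiberBundle.extChartAt] at h1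
      have := h1.2.1
      change (trivializationAt (F →L[ℝ] ℝ) (CotangentSpace F B) z₀.1 _).1 ∈ _ at this
      rw [trivializationAt_cotangent_apply] at this
      exact this
    exact ⟨h4, by rw [← h3, χ.left_inv h4], by rw [← h3]; exact χ.map_source h4⟩
  obtain ⟨h1, h2, h3⟩ := hbase y hy
  set z := φ.symm y with hz
  have hrange : Set.range (cotangentModel F) = Set.univ := by
    simp
  have hφd : MDifferentiableAt 𝓘(ℝ, F × (F →L[ℝ] ℝ)) (cotangentModel F) φ.symm y := by
    have := (contMDiffOn_extChartAt_symm (I := cotangentModel F) (n := ∞) z₀).contMDiffAt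
      (hopen.mem_nhds hy)
    exact this.mdifferentiableAt (by simp)
  have hπd : MDifferentiableAt (cotangentModel F) 𝓘(ℝ, F)
      (Bundle.TotalSpace.proj : CotangentBundle F B → B) z :=
    (Bundle.contMDiff_proj (CotangentSpace F B) (n := 1) z).mdifferentiableAt (by simp)
  have hχd : MDifferentiableAt 𝓘(ℝ, F) 𝓘(ℝ, F) χ.symm y.1 := by
    have := (contMDiffOn_extChartAt_symm (I := 𝓘(ℝ, F)) (n := ∞) z₀.1).contMDiffAt
      ((isOpen_extChartAt_target z₀.1).mem_nhds h3)
    exact this.mdifferentiableAt (by simp)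
  have hcomp : HasMFDerivAt 𝓘(ℝ, F × (F →L[ℝ] ℝ)) 𝓘(ℝ, F) (Bundle.TotalSpace.proj ∘ φ.symm) y
      ((mfderiv (cotangentModel F) 𝓘(ℝ, F)
        (Bundle.TotalSpace.proj : CotangentBundle F B → B) z).comp
        (mfderiv 𝓘(ℝ, F × (F →L[ℝ] ℝ)) (cotangentModel F) φ.symm y)) :=
    HasMFDerivAt.comp y hπd.hasMFDerivAt hφd.hasMFDerivAt
  have hcomp' : HasMFDerivAt 𝓘(ℝ, F × (F →L[ℝ] ℝ)) 𝓘(ℝ, F) (χ.symm ∘ Prod.fst) y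
      ((mfderiv 𝓘(ℝ, F) 𝓘(ℝ, F) χ.symm y.1).comp
        (ContinuousLinearMap.fst ℝ F (F →L[ℝ] ℝ))) :=
    HasMFDerivAt.comp y hχd.hasMFDerivAt hasFDerivAt_fst.hasMFDerivAt
  have heq : (Bundle.TotalSpace.proj ∘ φ.symm) =ᶠ[𝓝 y] (χ.symm ∘ Prod.fst) := by
    filter_upwards [hopen.mem_nhds hy] with w hw using (hbase w hw).2.1
  have hder := hasMFDerivAt_unique (hcomp.congr_of_eventuallyEq heq.symm) hcomp'
  have hframe : mfderiv 𝓘(ℝ, F) 𝓘(ℝ, F) χ.symm y.1 = chartFrame (F := F) z₀.1 z.1 := by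
    have h4 : z.1 ∈ (chartAt F z₀.1).source := by simpa [χ] using h1
    rw [chartFrame, TangentBundle.symmL_trivializationAt h4, ModelWithCorners.range_eq_univ,
      mfderivWithin_univ, ← hχ, h2, χ.right_inv h3]
  have hy2 : (z.2 : TangentSpace 𝓘(ℝ, F) z.1 →L[ℝ] ℝ).comp (chartFrame z₀.1 z.1) = y.2 := by
    have := φ.right_inv hy
    rw [hφ, extChartAt_cotangent_apply] at this
    exact congrArg Prod.snd this
  rw [hrange, mfderivWithin_univ]
  have e1 : (tautologicalForm z).comp (mfderiv 𝓘(ℝ, F × (F →L[ℝ] ℝ)) (cotangentModel F) φ.symm y) =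
      (z.2 : TangentSpace 𝓘(ℝ, F) z.1 →L[ℝ] ℝ).comp ((mfderiv (cotangentModel F) 𝓘(ℝ, F)
        (Bundle.TotalSpace.proj : CotangentBundle F B → B) z).comp
        (mfderiv 𝓘(ℝ, F × (F →L[ℝ] ℝ)) (cotangentModel F) φ.symm y)) := rfl
  refine e1.trans ?_
  ext1 v
  have e2 := DFunLike.congr_fun hder v
  rw [hframe] at e2
  have e3 := DFunLike.congr_fun hy2 v.1
  exact (congrArg (z.2 : TangentSpace 𝓘(ℝ, F) z.1 →L[ℝ] ℝ) e2).trans e3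

/-- In the preferred chart, the symplectic form of the cotangent bundle is the standard one. -/
theorem cotangentSymplectic_apply (z₀ : CotangentBundle F B) (ξ η : F × (F →L[ℝ] ℝ)) :
    cotangentSymplectic z₀ ξ η = η.2 ξ.1 - ξ.2 η.1 := by
  let Λ : F × (F →L[ℝ] ℝ) →L[ℝ] (F × (F →L[ℝ] ℝ) →L[ℝ] ℝ) :=
    ((ContinuousLinearMap.compL ℝ (F × (F →L[ℝ] ℝ)) F ℝ).flip
      (ContinuousLinearMap.fst ℝ F (F →L[ℝ] ℝ))).comp (ContinuousLinearMap.snd ℝ F (F →L[ℝ] ℝ))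
  have hrange : Set.range (cotangentModel F) = Set.univ := by
    simp
  let a : F × (F →L[ℝ] ℝ) → (F × (F →L[ℝ] ℝ) →L[ℝ] ℝ) := fun y =>
    (tautologicalForm ((extChartAt (cotangentModel F) z₀).symm y)).comp
      (mfderivWithin 𝓘(ℝ, F × (F →L[ℝ] ℝ)) (cotangentModel F) (extChartAt (cotangentModel F) z₀).symm
        (Set.range (cotangentModel F)) y)
  have h : HasFDerivAt a Λ (extChartAt (cotangentModel F) z₀ z₀) := by
    have hΛ : HasFDerivAt (fun y => Λ y) Λ (extChartAt (cotangentModel F) z₀ z₀) :=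
      ContinuousLinearMap.hasFDerivAt (E := F × (F →L[ℝ] ℝ)) (F := F × (F →L[ℝ] ℝ) →L[ℝ] ℝ) Λ
    refine hΛ.congr_of_eventuallyEq ?_
    filter_upwards [(isOpen_extChartAt_target z₀).mem_nhds (mem_extChartAt_target z₀)] with y hy
    exact tautologicalForm_comp_mfderivWithin_extChartAt_symm z₀ hy
  have h' : fderivWithin ℝ a (Set.range (cotangentModel F)) (extChartAt (cotangentModel F) z₀ z₀) =
      Λ := by
    rw [hrange, fderivWithin_univ]
    exact h.fderiv
  have e : cotangentSymplectic z₀ ξ η = - (Λ ξ η - Λ η ξ) := by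
    rw [← h']; rfl
  rw [e]
  exact neg_sub _ _

end CotangentChart

/-! ### Submersions of submanifolds and their fibers -/

section Fiber

variable {E : Type*} [NormedAddCommGroup E] [InnerProductSpace ℝ E]
  {F B : Type*} [NormedAddCommGroup F] [NormedSpace ℝ F]
  [TopologicalSpace B] [ChartedSpace F B]

/-- The map `f`, extended from `Q` by the retraction `ρ`, in the preferred chart at `b₀`. -/
def chartExpr (f : E → B) (ρ : E → E) (b₀ : B) (y : E) : F :=
  extChartAt 𝓘(ℝ, F) b₀ (f (ρ y))

variable {Q U : Set E} {f : E → B} {ρ : E → E} {b₀ : B}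

theorem IsSmoothSubmersionOn.hasMFDerivWithinAt (hf : IsSmoothSubmersionOn 𝓘(ℝ, F) f Q) {q : E}
    (hq : q ∈ Q) : HasMFDerivWithinAt 𝓘(ℝ, E) 𝓘(ℝ, F) f Q q (diffAlong (F := F) Q f q) :=
  ((hf.1 q hq).mdifferentiableWithinAt (by simp)).hasMFDerivWithinAt

theorem chartExpr_eq_iff (hρ : IsSmoothRetraction Q U ρ)
    (hs : ∀ y ∈ U, f (ρ y) ∈ (chartAt F b₀).source) {y y' : E} (hy : y ∈ Q ∩ U)
    (hy' : y' ∈ Q ∩ U) : chartExpr (F := F) f ρ b₀ y = chartExpr f ρ b₀ y' ↔ f y = f y' := by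
  have h1 := hs y hy.2
  have h2 := hs y' hy'.2
  rw [hρ.eq_self y hy] at h1
  rw [hρ.eq_self y' hy'] at h2
  rw [chartExpr, chartExpr, hρ.eq_self y hy, hρ.eq_self y' hy']
  exact (extChartAt 𝓘(ℝ, F) b₀).injOn.eq_iff (by simpa using h1) (by simpa using h2)

variable [IsManifold 𝓘(ℝ, F) ∞ B]

theorem hasFDerivAt_chartExpr (hf : IsSmoothSubmersionOn 𝓘(ℝ, F) f Q)
    (hρ : IsSmoothRetraction Q U ρ) {q : E} (hq : q ∈ Q ∩ U)
    (hs : f q ∈ (chartAt F b₀).source) :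
    HasFDerivAt (chartExpr (F := F) f ρ b₀)
      ((mfderiv 𝓘(ℝ, F) 𝓘(ℝ, F) (extChartAt 𝓘(ℝ, F) b₀) (f q)).comp
        ((diffAlong (F := F) Q f q).comp (fderiv ℝ ρ q))) q := by
  let G : E → E →L[ℝ] F := fun y =>
    (mfderiv 𝓘(ℝ, F) 𝓘(ℝ, F) (extChartAt 𝓘(ℝ, F) b₀) (f y)).comp
      ((diffAlong (F := F) Q f y).comp (fderiv ℝ ρ q))
  change HasFDerivAt _ (G q) q
  suffices h : HasFDerivAt (chartExpr (F := F) f ρ b₀) (G (ρ q)) q by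
    rwa [hρ.eq_self q hq] at h
  have hρq := hρ.mapsTo hq.2
  have h1 := hf.hasMFDerivWithinAt (F := F) hρq.1
  have h2 : HasMFDerivWithinAt 𝓘(ℝ, E) 𝓘(ℝ, E) ρ U q (fderiv ℝ ρ q) :=
    (hρ.hasFDerivAt hq.2).hasMFDerivAt.hasMFDerivWithinAt
  have h3 := (HasMFDerivWithinAt.comp q h1 h2 fun y hy => (hρ.mapsTo hy).1).hasMFDerivAt
    (hρ.isOpen.mem_nhds hq.2)
  have hs' : f (ρ q) ∈ (chartAt F b₀).source := by rwa [hρ.eq_self q hq]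
  have h4 : HasMFDerivAt 𝓘(ℝ, F) 𝓘(ℝ, F) (extChartAt 𝓘(ℝ, F) b₀) ((f ∘ ρ) q)
      (mfderiv 𝓘(ℝ, F) 𝓘(ℝ, F) (extChartAt 𝓘(ℝ, F) b₀) ((f ∘ ρ) q)) :=
    ((contMDiffAt_extChartAt' (n := ∞) hs').mdifferentiableAt (by simp)).hasMFDerivAt
  exact (HasMFDerivAt.comp q h4 h3).hasFDerivAt

theorem chartFrame_fderiv_chartExpr (hf : IsSmoothSubmersionOn 𝓘(ℝ, F) f Q)
    (hρ : IsSmoothRetraction Q U ρ) {q : E} (hq : q ∈ Q ∩ U)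
    (hs : f q ∈ (chartAt F b₀).source) {a : E} (ha : a ∈ tangentSpaceOf Q q) :
    chartFrame (F := F) b₀ (f q) (fderiv ℝ (chartExpr (F := F) f ρ b₀) q a) =
      diffAlong (F := F) Q f q a := by
  have hd := hasFDerivAt_chartExpr hf hρ hq hs
  have hd' : HasFDerivAt (chartExpr (F := F) f ρ b₀) (fderiv ℝ (chartExpr f ρ b₀) q) q :=
    hd.differentiableAt.hasFDerivAt
  have h1 : fderiv ℝ (chartExpr (F := F) f ρ b₀) q a =
      mfderiv 𝓘(ℝ, F) 𝓘(ℝ, F) (extChartAt 𝓘(ℝ, F) b₀) (f q)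
        (diffAlong (F := F) Q f q (fderiv ℝ ρ q a)) := DFunLike.congr_fun (hd'.unique hd) a
  rw [← TangentBundle.continuousLinearMapAt_trivializationAt hs,
    (hρ.mem_tangentSpaceOf_iff hq).1 ha] at h1
  exact (congrArg (chartFrame (F := F) b₀ (f q)) h1).trans
    (Bundle.Trivialization.symmL_continuousLinearMapAt _ (by simpa using hs) _)

theorem chartFrame_self (b : B) (v : F) : chartFrame (F := F) b b v = v := by
  have h : b ∈ (chartAt F b).source := mem_chart_source F b
  rw [chartFrame, TangentBundle.symmL_trivializationAt_eq_core h]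
  exact (tangentBundleCore 𝓘(ℝ, F) B).coordChange_self (achart F b) b h v

theorem chartFrame_injective {b : B} (hb : b ∈ (chartAt F b₀).source) :
    Function.Injective (chartFrame (F := F) b₀ b) :=
  Function.LeftInverse.injective (g := Bundle.Trivialization.continuousLinearMapAt ℝ
      (trivializationAt F (TangentSpace 𝓘(ℝ, F)) b₀) b) fun v =>
    Bundle.Trivialization.continuousLinearMapAt_symmL _ (by simpa using hb) v

/-- A retraction can be restricted so that `f ∘ ρ` stays in the domain of a given chart. -/
theorem exists_contDiffOn_chartExpr (hf : IsSmoothSubmersionOn 𝓘(ℝ, F) f Q)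
    (hρ : IsSmoothRetraction Q U ρ) {q : E} (hq : q ∈ Q ∩ U)
    (hs : f q ∈ (chartAt F b₀).source) :
    ∃ U' ⊆ U, q ∈ U' ∧ IsSmoothRetraction Q U' ρ ∧ (∀ y ∈ U', f (ρ y) ∈ (chartAt F b₀).source) ∧
      ContDiffOn ℝ ∞ (chartExpr (F := F) f ρ b₀) U' := by
  have h1 : ContMDiffOn 𝓘(ℝ, E) 𝓘(ℝ, F) ∞ (f ∘ ρ) U :=
    hf.1.comp hρ.contDiffOn.contMDiffOn fun y hy => (hρ.mapsTo hy).1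
  have hO : IsOpen (U ∩ (f ∘ ρ) ⁻¹' (chartAt F b₀).source) :=
    h1.continuousOn.isOpen_inter_preimage hρ.isOpen (chartAt F b₀).open_source
  obtain ⟨U', hU', hqU', hret⟩ := hρ.exists_restrict hO hq
    ⟨hq.2, by rw [Set.mem_preimage, Function.comp_apply, hρ.eq_self q hq]; exact hs⟩
  refine ⟨U', fun y hy => (hU' hy).1, hqU', hret, fun y hy => (hU' hy).2.2, ?_⟩
  rw [← contMDiffOn_iff_contDiffOn]
  exact (contMDiffOn_extChartAt (n := ∞)).comp (h1.mono fun y hy => (hU' hy).1)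
    fun y hy => (hU' hy).2.2

variable [FiniteDimensional ℝ E] [FiniteDimensional ℝ F]

/-- The fibers of a submersion are smooth retracts, with the kernel of the differential as tangent
space. -/
theorem exists_isSmoothRetraction_fiber {d : ℕ} (hQ : IsEmbeddedSubmanifold d Q)
    (hf : IsSmoothSubmersionOn 𝓘(ℝ, F) f Q) {q : E} (hq : q ∈ Q) :
    (∃ U ρ, q ∈ U ∧ IsSmoothRetraction (Q ∩ f ⁻¹' {f q}) U ρ) ∧
    ∀ v, v ∈ verticalSpace Q f q ↔ v ∈ tangentSpaceOf Q q ∧ diffAlong (F := F) Q f q v = 0 := by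
  obtain ⟨k, U, C, hk, hU, hqU, hC, hSU, hsurj⟩ := hQ q hq
  obtain ⟨U₁, ρ, hqU₁, hU₁, hρ₁, hT⟩ :=
    exists_isSmoothRetraction_of_regular hU hC hSU ⟨hq, hqU⟩ (hsurj q ⟨hq, hqU⟩)
  have hs : f q ∈ (chartAt F (f q)).source := mem_chart_source F (f q)
  obtain ⟨U₂, hU₂, hqU₂, hρ, hs₂, hg⟩ := exists_contDiffOn_chartExpr hf hρ₁ ⟨hq, hqU₁⟩ hs
  let g := chartExpr (F := F) f ρ (f q)
  have hqQ : q ∈ Q ∩ U₂ := ⟨hq, hqU₂⟩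
  have hgd : HasFDerivAt g (fderiv ℝ g q) q :=
    (hasFDerivAt_chartExpr hf hρ hqQ hs).differentiableAt.hasFDerivAt
  have hgT : ∀ v ∈ tangentSpaceOf Q q, fderiv ℝ g q v = diffAlong (F := F) Q f q v := by
    intro v hv
    have := chartFrame_fderiv_chartExpr hf hρ hqQ hs hv
    rwa [chartFrame_self] at this
  let C₂ : E → (Fin k → ℝ) × F := fun y => (C y, g y - g q)
  have hC₂ : ContDiffOn ℝ ∞ C₂ U₂ :=
    (hC.mono (hU₂.trans hU₁)).prodMk (hg.sub contDiffOn_const)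
  have hCd : HasFDerivAt C (fderiv ℝ C q) q :=
    ((hC.contDiffAt (hU.mem_nhds hqU)).differentiableAt (by simp)).hasFDerivAt
  have hC₂d : fderiv ℝ C₂ q = (fderiv ℝ C q).prod (fderiv ℝ g q) :=
    (hCd.prodMk (hgd.sub_const (g q))).fderiv
  have hmem : ∀ v, v ∈ tangentSpaceOf Q q ↔ fderiv ℝ C q v = 0 := by
    intro v; rw [hT]; exact LinearMap.mem_ker
  obtain ⟨U₃, ρ₃, hq₃, -, hρ₃, hT₃⟩ := exists_isSmoothRetraction_of_regular
    (S := Q ∩ f ⁻¹' {f q}) hρ.isOpen hC₂ (by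
      ext y
      constructor
      · rintro ⟨⟨hyQ, hyf⟩, hyU⟩
        have h1 : y ∈ Q ∩ U := ⟨hyQ, hU₁ (hU₂ hyU)⟩
        rw [hSU] at h1
        refine ⟨hyU, Prod.ext h1.2 (sub_eq_zero.2 ?_)⟩
        exact (chartExpr_eq_iff hρ hs₂ ⟨hyQ, hyU⟩ hqQ).2 hyf
      · rintro ⟨hyU, hy⟩
        have h1 : y ∈ Q ∩ U := by
          rw [hSU]; exact ⟨hU₁ (hU₂ hyU), congrArg Prod.fst hy⟩
        exact ⟨⟨h1.1, (chartExpr_eq_iff hρ hs₂ ⟨h1.1, hyU⟩ hqQ).1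
          (sub_eq_zero.1 (congrArg Prod.snd hy))⟩, hyU⟩)
    (x := q) ⟨⟨hq, rfl⟩, hqU₂⟩ (by
      rw [hC₂d]
      rintro ⟨c, w⟩
      obtain ⟨v, rfl⟩ := hsurj q ⟨hq, hqU⟩ c
      obtain ⟨t, ht, htw⟩ := hf.2 q hq (w - fderiv ℝ g q v : F)
      refine ⟨v + t, Prod.ext ?_ ?_⟩
      · change fderiv ℝ C q (v + t) = _
        rw [map_add, (hmem t).1 ht, add_zero]
      · change fderiv ℝ g q (v + t) = w
        rw [map_add, hgT t ht]
        have : diffAlong (F := F) Q f q t = (w - fderiv ℝ g q v : F) := htw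
        rw [this]
        exact add_sub_cancel (fderiv ℝ g q v) w)
  refine ⟨⟨U₃, ρ₃, hq₃, hρ₃⟩, fun v => ?_⟩
  rw [verticalSpace, hT₃, LinearMap.mem_ker, hmem, hC₂d]
  constructor
  · intro h
    have h1 : fderiv ℝ C q v = 0 := congrArg Prod.fst h
    refine ⟨h1, ?_⟩
    rw [← hgT v ((hmem v).2 h1)]
    exact congrArg Prod.snd h
  · rintro ⟨h1, h2⟩
    refine Prod.ext h1 ?_
    change fderiv ℝ g q v = 0
    rw [hgT v ((hmem v).2 h1)]
    exact h2

theorem finrank_verticalSpace_add {d : ℕ} (hQ : IsEmbeddedSubmanifold d Q)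
    (hf : IsSmoothSubmersionOn 𝓘(ℝ, F) f Q) {q : E} (hq : q ∈ Q) :
    Module.finrank ℝ (verticalSpace Q f q) + Module.finrank ℝ F = d := by
  have hd := (hQ.exists_isSmoothRetraction hq).2
  let L : E →ₗ[ℝ] F := (diffAlong (F := F) Q f q : E →L[ℝ] F).toLinearMap
  let D : tangentSpaceOf Q q →ₗ[ℝ] F := L.comp (tangentSpaceOf Q q).subtype
  have hr : LinearMap.range D = ⊤ := by
    refine LinearMap.range_eq_top.2 fun w => ?_
    obtain ⟨v, hv, hvw⟩ := hf.2 q hq w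
    exact ⟨⟨v, hv⟩, hvw⟩
  have h1 := D.finrank_range_add_finrank_ker
  have h2 : (LinearMap.ker D).map (tangentSpaceOf Q q).subtype = verticalSpace Q f q := by
    ext v
    rw [(exists_isSmoothRetraction_fiber hQ hf hq).2 v]
    constructor
    · rintro ⟨w, hw, rfl⟩
      exact ⟨w.2, hw⟩
    · rintro ⟨hv, hv'⟩
      exact ⟨⟨v, hv⟩, hv', rfl⟩
  rw [hr, finrank_top, hd] at h1
  have h3 := (Submodule.equivMapOfInjective (tangentSpaceOf Q q).subtype
    (tangentSpaceOf Q q).injective_subtype (LinearMap.ker D)).finrank_eq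
  rw [← h2, ← h3]
  omega

theorem isEmbeddedSubmanifold_fiber {d : ℕ} (hQ : IsEmbeddedSubmanifold d Q)
    (hf : IsSmoothSubmersionOn 𝓘(ℝ, F) f Q) (b : B) :
    IsEmbeddedSubmanifold (d - Module.finrank ℝ F) (Q ∩ f ⁻¹' {b}) := by
  refine isEmbeddedSubmanifold_of_isSmoothRetraction ?_
  rintro q ⟨hq, rfl⟩
  obtain ⟨⟨U, ρ, hqU, hρ⟩, -⟩ := exists_isSmoothRetraction_fiber hQ hf hq
  refine ⟨U, ρ, hqU, hρ, ?_⟩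
  have h1 := finrank_verticalSpace_add hQ hf hq
  have h2 : Module.finrank ℝ (verticalSpace Q f q) = d - Module.finrank ℝ F := by omega
  exact h2

end Fiber

/-! ### Horizontal splittings -/

section Splitting

variable {E : Type*} [NormedAddCommGroup E] [InnerProductSpace ℝ E]
  {F B : Type*} [NormedAddCommGroup F] [NormedSpace ℝ F]
  [TopologicalSpace B] [ChartedSpace F B]

/-- A submersion `f` of the submanifold `Q` of dimension `d`, a projection function `P` onto its
tangent bundle, a complement `Hor` of the vertical bundle, and the corresponding decomposition
`P = PH + PV`. -/
structure IsHorizontalSplitting (F : Type*) [NormedAddCommGroup F] [NormedSpace ℝ F]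
    [ChartedSpace F B] (d : ℕ) (Q : Set E) (f : E → B)
    (P : E → E →L[ℝ] E) (Hor : E → Submodule ℝ E) (PH PV : E → E →L[ℝ] E) : Prop where
  submanifold : IsEmbeddedSubmanifold d Q
  submersion : IsSmoothSubmersionOn 𝓘(ℝ, F) f Q
  contDiffOn_proj : ContDiffOn ℝ ∞ P Q
  proj_idem : ∀ q ∈ Q, (P q).comp (P q) = P q
  range_proj : ∀ q ∈ Q, LinearMap.range (P q).toLinearMap = tangentSpaceOf Q q
  subbundle : IsSmoothSubbundle Q Hor
  inf_eq : ∀ q ∈ Q, Hor q ⊓ verticalSpace Q f q = ⊥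
  sup_eq : ∀ q ∈ Q, Hor q ⊔ verticalSpace Q f q = tangentSpaceOf Q q
  dec : ∀ q ∈ Q, ∀ e, PH q e ∈ Hor q ∧ PV q e ∈ verticalSpace Q f q ∧ PH q e + PV q e = P q e

/-- The retraction `ρ` of `U` onto `Q ∩ U` is such that `f ∘ ρ` takes values in the domain of the
chart at `b₀`. -/
structure IsAdaptedRetraction (Q : Set E) (f : E → B) (b₀ : B) (U : Set E) (ρ : E → E) : Prop
    extends IsSmoothRetraction Q U ρ where
  mem_source : ∀ y ∈ U, f (ρ y) ∈ (chartAt F b₀).source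
  contDiffOn_chartExpr : ContDiffOn ℝ ∞ (chartExpr (F := F) f ρ b₀) U

variable {d : ℕ} {Q : Set E} {f : E → B} {P : E → E →L[ℝ] E} {Hor : E → Submodule ℝ E}
  {PH PV : E → E →L[ℝ] E} {U : Set E} {ρ : E → E} {b₀ : B} {q : E}

namespace IsAdaptedRetraction

theorem mem_source_self (hρ : IsAdaptedRetraction (F := F) Q f b₀ U ρ) (hq : q ∈ Q ∩ U) :
    f q ∈ (chartAt F b₀).source := by
  have := hρ.mem_source q hq.2
  rwa [hρ.eq_self q hq] at this

theorem hasFDerivAt_chartExpr (hρ : IsAdaptedRetraction (F := F) Q f b₀ U ρ) {y : E} (hy : y ∈ U) :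
    HasFDerivAt (chartExpr (F := F) f ρ b₀) (fderiv ℝ (chartExpr (F := F) f ρ b₀) y) y :=
  ((hρ.contDiffOn_chartExpr.contDiffAt (hρ.isOpen.mem_nhds hy)).differentiableAt
    (by simp)).hasFDerivAt

theorem chartExpr_retraction (hρ : IsAdaptedRetraction (F := F) Q f b₀ U ρ) {y : E} (hy : y ∈ U) :
    chartExpr (F := F) f ρ b₀ (ρ y) = chartExpr f ρ b₀ y := by
  rw [chartExpr, chartExpr, hρ.idem hy]

/-- The differential of `f ∘ ρ` factors through that of `ρ`. -/
theorem fderiv_chartExpr_comp (hρ : IsAdaptedRetraction (F := F) Q f b₀ U ρ) {y : E} (hy : y ∈ U)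
    (a : E) : fderiv ℝ (chartExpr (F := F) f ρ b₀) (ρ y) (fderiv ℝ ρ y a) =
      fderiv ℝ (chartExpr (F := F) f ρ b₀) y a := by
  have h1 := (hρ.hasFDerivAt_chartExpr (hρ.mapsTo hy).2).comp y (hρ.hasFDerivAt hy)
  have h2 : chartExpr (F := F) f ρ b₀ ∘ ρ =ᶠ[𝓝 y] chartExpr f ρ b₀ := by
    filter_upwards [hρ.isOpen.mem_nhds hy] with z hz using hρ.chartExpr_retraction hz
  exact DFunLike.congr_fun ((h1.congr_of_eventuallyEq h2.symm).unique
    (hρ.hasFDerivAt_chartExpr hy)) a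

end IsAdaptedRetraction

namespace IsHorizontalSplitting

section Algebra

variable (h : IsHorizontalSplitting F d Q f P Hor PH PV)
include h

theorem hor_le (hq : q ∈ Q) : Hor q ≤ tangentSpaceOf Q q := h.sup_eq q hq ▸ le_sup_left

theorem vert_le (hq : q ∈ Q) : verticalSpace Q f q ≤ tangentSpaceOf Q q :=
  h.sup_eq q hq ▸ le_sup_right

theorem eq_zero_of_mem (hq : q ∈ Q) {v : E} (h1 : v ∈ Hor q) (h2 : v ∈ verticalSpace Q f q) :
    v = 0 := by
  have : v ∈ Hor q ⊓ verticalSpace Q f q := ⟨h1, h2⟩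
  rwa [h.inf_eq q hq, Submodule.mem_bot] at this

theorem proj_apply_of_mem (hq : q ∈ Q) {v : E} (hv : v ∈ tangentSpaceOf Q q) : P q v = v := by
  rw [← h.range_proj q hq] at hv
  obtain ⟨w, rfl⟩ := hv
  exact DFunLike.congr_fun (h.proj_idem q hq) w

theorem proj_mem (hq : q ∈ Q) (e : E) : P q e ∈ tangentSpaceOf Q q :=
  h.range_proj q hq ▸ ⟨e, rfl⟩

/-- The decomposition into a horizontal and a vertical part is unique. -/
theorem projH_eq (hq : q ∈ Q) {e a b : E} (ha : a ∈ Hor q) (hb : b ∈ verticalSpace Q f q)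
    (hab : a + b = P q e) : PH q e = a := by
  obtain ⟨h1, h2, h3⟩ := h.dec q hq e
  have h4 : PH q e - a = b - PV q e := by
    rw [sub_eq_sub_iff_add_eq_add, h3, add_comm b a, hab]
  refine sub_eq_zero.1 (h.eq_zero_of_mem hq (Submodule.sub_mem _ h1 ha) ?_)
  rw [h4]; exact Submodule.sub_mem _ hb h2

theorem projH_of_mem_hor (hq : q ∈ Q) {e : E} (he : e ∈ Hor q) : PH q e = e :=
  h.projH_eq hq he (zero_mem _) (by rw [add_zero, h.proj_apply_of_mem hq (h.hor_le hq he)])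

theorem projH_mem (hq : q ∈ Q) (e : E) : PH q e ∈ Hor q := (h.dec q hq e).1

theorem projH_idem (hq : q ∈ Q) (e : E) : PH q (PH q e) = PH q e :=
  h.projH_of_mem_hor hq (h.projH_mem hq e)

theorem range_projH (hq : q ∈ Q) : LinearMap.range (PH q).toLinearMap = Hor q := by
  ext e
  constructor
  · rintro ⟨v, rfl⟩; exact h.projH_mem hq v
  · exact fun he => ⟨e, h.projH_of_mem_hor hq he⟩

theorem projH_proj (hq : q ∈ Q) (e : E) : PH q (P q e) = PH q e := by
  obtain ⟨h1, h2, h3⟩ := h.dec q hq e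
  exact h.projH_eq hq h1 h2 (h3.trans (h.proj_apply_of_mem hq (h.proj_mem hq e)).symm)

theorem projV_eq (hq : q ∈ Q) : PV q = P q - PH q := by
  ext e
  exact eq_sub_of_add_eq' (h.dec q hq e).2.2

end Algebra

section Bundle

variable [IsManifold 𝓘(ℝ, F) ∞ B] (h : IsHorizontalSplitting F d Q f P Hor PH PV)
include h

theorem chartFrame_fderiv (hρ : IsAdaptedRetraction (F := F) Q f b₀ U ρ) (hq : q ∈ Q ∩ U) {a : E}
    (ha : a ∈ tangentSpaceOf Q q) :
    chartFrame (F := F) b₀ (f q) (fderiv ℝ (chartExpr (F := F) f ρ b₀) q a) =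
      diffAlong (F := F) Q f q a :=
  chartFrame_fderiv_chartExpr h.submersion hρ.toIsSmoothRetraction hq (hρ.mem_source_self hq) ha

variable [FiniteDimensional ℝ E]

theorem exists_isAdaptedRetraction (hq : q ∈ Q) :
    ∃ U ρ, q ∈ U ∧ IsAdaptedRetraction (F := F) Q f (f q) U ρ := by
  obtain ⟨⟨U, ρ, hqU, hρ⟩, -⟩ := h.submanifold.exists_isSmoothRetraction hq
  obtain ⟨U', -, hqU', hρ', hs, hg⟩ := exists_contDiffOn_chartExpr h.submersion hρ ⟨hq, hqU⟩
    (mem_chart_source F (f q))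
  exact ⟨U', ρ, hqU', hρ', hs, hg⟩

variable [FiniteDimensional ℝ F]

theorem mem_vert_iff (hq : q ∈ Q) {v : E} : v ∈ verticalSpace Q f q ↔
    v ∈ tangentSpaceOf Q q ∧ diffAlong (F := F) Q f q v = 0 :=
  (exists_isSmoothRetraction_fiber h.submanifold h.submersion hq).2 v

theorem diffAlong_projH (hq : q ∈ Q) {v : E} (hv : v ∈ tangentSpaceOf Q q) :
    diffAlong (F := F) Q f q (PH q v) = diffAlong (F := F) Q f q v := by
  obtain ⟨-, h2, h3⟩ := h.dec q hq v
  rw [h.proj_apply_of_mem hq hv] at h3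
  conv_rhs => rw [← h3]
  exact ((map_add (diffAlong (F := F) Q f q) _ _).trans
    (by rw [((h.mem_vert_iff hq).1 h2).2]; exact add_zero _)).symm

theorem bijOn_diffAlong (hq : q ∈ Q) :
    Set.BijOn (diffAlong (F := F) Q f q) (Hor q) Set.univ := by
  refine ⟨fun _ _ => Set.mem_univ _, ?_, ?_⟩
  · intro a ha b hb hab
    refine sub_eq_zero.1 (h.eq_zero_of_mem hq (Submodule.sub_mem _ ha hb) ?_)
    refine (h.mem_vert_iff hq).2 ⟨h.hor_le hq (Submodule.sub_mem _ ha hb), ?_⟩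
    exact (map_sub (diffAlong (F := F) Q f q) a b).trans (sub_eq_zero.2 hab)
  · rintro w -
    obtain ⟨v, hv, hvw⟩ := h.submersion.2 q hq w
    exact ⟨PH q v, h.projH_mem hq v, (h.diffAlong_projH hq hv).trans hvw⟩

theorem fderiv_chartExpr_eq_zero_iff (hρ : IsAdaptedRetraction (F := F) Q f b₀ U ρ)
    (hq : q ∈ Q ∩ U) {a : E} (ha : a ∈ tangentSpaceOf Q q) :
    fderiv ℝ (chartExpr (F := F) f ρ b₀) q a = 0 ↔ a ∈ verticalSpace Q f q := by
  rw [h.mem_vert_iff hq.1, and_iff_right ha, ← h.chartFrame_fderiv hρ hq ha]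
  exact (map_eq_zero_iff _ (chartFrame_injective (hρ.mem_source_self hq))).symm

theorem fderiv_chartExpr_projH (hρ : IsAdaptedRetraction (F := F) Q f b₀ U ρ)
    (hq : q ∈ Q ∩ U) {a : E} (ha : a ∈ tangentSpaceOf Q q) :
    fderiv ℝ (chartExpr (F := F) f ρ b₀) q (PH q a) =
      fderiv ℝ (chartExpr (F := F) f ρ b₀) q a := by
  obtain ⟨-, h2, h3⟩ := h.dec q hq.1 a
  rw [h.proj_apply_of_mem hq.1 ha] at h3
  conv_rhs => rw [← h3]
  rw [map_add, (h.fderiv_chartExpr_eq_zero_iff hρ hq (h.vert_le hq.1 h2)).2 h2, add_zero]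

theorem exists_mem_hor_fderiv_eq (hρ : IsAdaptedRetraction (F := F) Q f b₀ U ρ) (hq : q ∈ Q ∩ U)
    (w : F) : ∃ a ∈ Hor q, fderiv ℝ (chartExpr (F := F) f ρ b₀) q a = w := by
  obtain ⟨a, ha, haw⟩ := (h.bijOn_diffAlong hq.1).surjOn
    (Set.mem_univ (chartFrame (F := F) b₀ (f q) w))
  refine ⟨a, ha, chartFrame_injective (hρ.mem_source_self hq) ?_⟩
  exact (h.chartFrame_fderiv hρ hq (h.hor_le hq.1 ha)).trans haw

/-- The vertical spaces form a smooth bundle: if `R₀` is a right inverse of `D g(q₀)`, where `g`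
is `f ∘ ρ` in a chart, then `Dρ - Dρ R₀ (Dg R₀)⁻¹ Dg` projects onto them. -/
theorem isSmoothSubbundle_vert : IsSmoothSubbundle Q (verticalSpace Q f) := by
  intro q₀ hq₀
  obtain ⟨U, ρ, hqU, hρ⟩ := h.exists_isAdaptedRetraction hq₀
  have hq₀U : q₀ ∈ Q ∩ U := ⟨hq₀, hqU⟩
  set g := chartExpr (F := F) f ρ (f q₀) with hg
  have hsurj : Function.Surjective (fderiv ℝ g q₀) := fun w =>
    let ⟨a, _, ha⟩ := h.exists_mem_hor_fderiv_eq hρ hq₀U w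
    ⟨a, ha⟩
  obtain ⟨R, hR⟩ := (fderiv ℝ g q₀).toLinearMap.exists_rightInverse_of_surjective
    (LinearMap.range_eq_top.2 hsurj)
  let R₀ : F →L[ℝ] E := R.toContinuousLinearMap
  have hR₀ : ∀ c, fderiv ℝ g q₀ (R₀ c) = c := fun c => DFunLike.congr_fun hR c
  let M : E → F →L[ℝ] F := fun y => (fderiv ℝ g y).comp R₀
  have hgs : ContDiffOn ℝ ∞ (fderiv ℝ g) U :=
    hρ.contDiffOn_chartExpr.fderiv_of_isOpen hρ.isOpen (by simp)
  have hρs : ContDiffOn ℝ ∞ (fderiv ℝ ρ) U :=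
    hρ.contDiffOn.fderiv_of_isOpen hρ.isOpen (by simp)
  have hM : ContDiffOn ℝ ∞ M U := hgs.clm_comp contDiffOn_const
  let O : Set E := U ∩ M ⁻¹' Set.range ContinuousLinearEquiv.toContinuousLinearMap
  have hO : IsOpen O := hM.continuousOn.isOpen_inter_preimage hρ.isOpen ContinuousLinearEquiv.isOpen
  have hq₀O : q₀ ∈ O := ⟨hqU, ContinuousLinearEquiv.refl ℝ F, by ext1 c; simp [M, hR₀]⟩
  have hMi : ContDiffOn ℝ ∞ (fun y => (M y).inverse) O := by
    rintro y ⟨hyU, e, he⟩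
    have h1 := contDiffAt_map_inverse (n := ∞) e
    have he' : (e : F →L[ℝ] F) = M y := he
    rw [he'] at h1
    exact h1.comp_contDiffWithinAt y ((hM y hyU).mono Set.inter_subset_left)
  let Λ : E → E →L[ℝ] E := fun y =>
    fderiv ℝ ρ y - (fderiv ℝ ρ y).comp (R₀.comp ((M y).inverse.comp (fderiv ℝ g y)))
  have hΛ : ContDiffOn ℝ ∞ Λ O := by
    have h1 := hρs.mono (Set.inter_subset_left : O ⊆ U)
    have h2 := hgs.mono (Set.inter_subset_left : O ⊆ U)
    exact h1.sub (h1.clm_comp (contDiffOn_const.clm_comp (hMi.clm_comp h2)))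
  have hmem : ∀ y ∈ Q ∩ O, ∀ v, Λ y v ∈ verticalSpace Q f y := by
    rintro y ⟨hyQ, hyU, e, he⟩ v
    have hy : y ∈ Q ∩ U := ⟨hyQ, hyU⟩
    have hT : Λ y v ∈ tangentSpaceOf Q y :=
      Submodule.sub_mem _ (hρ.fderiv_mem hy _) (hρ.fderiv_mem hy _)
    rw [← h.fderiv_chartExpr_eq_zero_iff hρ hy hT]
    have hGD : ∀ a, fderiv ℝ g y (fderiv ℝ ρ y a) = fderiv ℝ g y a := by
      intro a
      have := hρ.fderiv_chartExpr_comp hyU a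
      rwa [hρ.eq_self y hy] at this
    have hinv : ∀ c, fderiv ℝ g y (R₀ ((M y).inverse c)) = c := by
      intro c
      have he' : M y = (e : F →L[ℝ] F) := he.symm
      have h1 : M y (e.symm c) = c := by rw [he']; simp
      rw [he', ContinuousLinearMap.inverse_equiv]
      exact h1
    change fderiv ℝ g y (fderiv ℝ ρ y v -
      fderiv ℝ ρ y (R₀ ((M y).inverse (fderiv ℝ g y v)))) = 0
    rw [map_sub, hGD, hGD, hinv, sub_self]
  let r := Module.finrank ℝ (verticalSpace Q f q₀)
  let b := Module.finBasis ℝ (verticalSpace Q f q₀)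
  let s : Fin r → E → E := fun i y => Λ y (b i)
  have hs : ∀ i, ContDiffOn ℝ ∞ (s i) O := fun i => hΛ.clm_apply contDiffOn_const
  have hs₀ : ∀ i, s i q₀ = b i := by
    intro i
    have h1 : ((b i : verticalSpace Q f q₀) : E) ∈ verticalSpace Q f q₀ := (b i).2
    have h2 := h.vert_le hq₀ h1
    change fderiv ℝ ρ q₀ (b i) -
      fderiv ℝ ρ q₀ (R₀ ((M q₀).inverse (fderiv ℝ g q₀ (b i)))) = b i
    rw [(h.fderiv_chartExpr_eq_zero_iff hρ hq₀U h2).2 h1, map_zero, map_zero, map_zero, sub_zero,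
      (hρ.mem_tangentSpaceOf_iff hq₀U).1 h2]
  let O' : Set E := O ∩ (fun y i => s i y) ⁻¹' {v | LinearIndependent ℝ v}
  have hO' : IsOpen O' := (continuousOn_pi.2 fun i => (hs i).continuousOn).isOpen_inter_preimage hO
    isOpen_setOfPred_linearIndependent
  refine ⟨O', r, s, hO', ⟨hq₀O, ?_⟩, fun i => (hs i).mono fun y hy => hy.2.1, ?_⟩
  · change LinearIndependent ℝ fun i => s i q₀
    simp only [hs₀]
    exact b.linearIndependent.map' _ (Submodule.ker_subtype _)
  · rintro y ⟨hyQ, hyO, hli⟩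
    have hli' : LinearIndependent ℝ fun i => s i y := hli
    refine ⟨hli', Submodule.eq_of_le_of_finrank_eq ?_ ?_⟩
    · rw [Submodule.span_le]
      rintro _ ⟨i, rfl⟩
      exact hmem y ⟨hyQ, hyO⟩ _
    · rw [finrank_span_eq_card hli', Fintype.card_fin]
      have h1 := finrank_verticalSpace_add h.submanifold h.submersion hq₀
      have h2 := finrank_verticalSpace_add h.submanifold h.submersion hyQ
      change Module.finrank ℝ (verticalSpace Q f q₀) = _
      omega

/-- The horizontal projection is smooth: with a frame `A` of the horizontal bundle and
`g` the map `f ∘ ρ` in a chart, it is `A (Dg A)⁻¹ Dg P`. -/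
theorem contDiffOn_projH : ContDiffOn ℝ ∞ PH Q := by
  intro q₀ hq₀
  obtain ⟨U, ρ, hqU, hρ⟩ := h.exists_isAdaptedRetraction hq₀
  obtain ⟨U₁, r, s, hU₁, hqU₁, hs, hframe⟩ := h.subbundle q₀ hq₀
  set g := chartExpr (F := F) f ρ (f q₀) with hg
  let A : E → (Fin r → ℝ) →L[ℝ] E := fun y =>
    ∑ i, (ContinuousLinearMap.proj i : (Fin r → ℝ) →L[ℝ] ℝ).smulRight (s i y)
  have hAapp : ∀ y c, A y c = ∑ i, c i • s i y := by
    intro y c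
    simp [A]
  have hA : ContDiffOn ℝ ∞ A (Q ∩ U₁) := by
    refine ContDiffOn.sum fun i _ => ?_
    exact (ContinuousLinearMap.smulRightL ℝ (Fin r → ℝ) E
      (ContinuousLinearMap.proj i)).contDiff.comp_contDiffOn (hs i)
  have hAr : ∀ y ∈ Q ∩ U₁, ∀ v, v ∈ Hor y ↔ ∃ c, A y c = v := by
    intro y hy v
    rw [← (hframe y hy).2, Submodule.mem_span_range_iff_exists_fun]
    simp only [hAapp]
  have hAi : ∀ y ∈ Q ∩ U₁, ∀ c, A y c = 0 → c = 0 := by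
    intro y hy c hc
    rw [hAapp] at hc
    exact funext (Fintype.linearIndependent_iff.1 (hframe y hy).1 c hc)
  let M : E → (Fin r → ℝ) →L[ℝ] F := fun y => (fderiv ℝ g y).comp (A y)
  have hbij : ∀ y ∈ Q ∩ (U ∩ U₁), Function.Bijective (M y) := by
    intro y hy
    have hyU : y ∈ Q ∩ U := ⟨hy.1, hy.2.1⟩
    have hyU₁ : y ∈ Q ∩ U₁ := ⟨hy.1, hy.2.2⟩
    constructor
    · refine (injective_iff_map_eq_zero (M y)).2 fun c hc => hAi y hyU₁ c ?_
      have h1 : A y c ∈ Hor y := (hAr y hyU₁ _).2 ⟨c, rfl⟩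
      exact h.eq_zero_of_mem hy.1 h1
        ((h.fderiv_chartExpr_eq_zero_iff hρ hyU (h.hor_le hy.1 h1)).1 hc)
    · intro w
      obtain ⟨a, ha, haw⟩ := h.exists_mem_hor_fderiv_eq hρ hyU w
      obtain ⟨c, rfl⟩ := (hAr y hyU₁ _).1 ha
      exact ⟨c, haw⟩
  have hgs : ContDiffOn ℝ ∞ (fderiv ℝ g) U :=
    hρ.contDiffOn_chartExpr.fderiv_of_isOpen hρ.isOpen (by simp)
  have hq₀' : q₀ ∈ Q ∩ (U ∩ U₁) := ⟨hq₀, hqU, hqU₁⟩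
  have hM : ContDiffOn ℝ ∞ M (Q ∩ (U ∩ U₁)) :=
    (hgs.mono fun y hy => hy.2.1).clm_comp (hA.mono fun y hy => ⟨hy.1, hy.2.2⟩)
  let eM : ∀ y ∈ Q ∩ (U ∩ U₁), (Fin r → ℝ) ≃L[ℝ] F := fun y hy =>
    (LinearEquiv.ofBijective (M y).toLinearMap (hbij y hy)).toContinuousLinearEquiv
  have heM : ∀ y (hy : y ∈ Q ∩ (U ∩ U₁)), (eM y hy : (Fin r → ℝ) →L[ℝ] F) = M y :=
    fun y hy => by ext1 c; rfl
  have hMi : ContDiffWithinAt ℝ ∞ (fun y => (M y).inverse) (Q ∩ (U ∩ U₁)) q₀ := by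
    have h1 := contDiffAt_map_inverse (n := ∞) (eM q₀ hq₀')
    rw [heM q₀ hq₀'] at h1
    exact h1.comp_contDiffWithinAt q₀ (hM q₀ hq₀')
  have hO : U ∩ U₁ ∈ 𝓝 q₀ := Filter.inter_mem (hρ.isOpen.mem_nhds hqU) (hU₁.mem_nhds hqU₁)
  rw [← contDiffWithinAt_inter hO]
  have hRHS : ContDiffWithinAt ℝ ∞
      (fun y => (A y).comp ((M y).inverse.comp ((fderiv ℝ g y).comp (P y))))
      (Q ∩ (U ∩ U₁)) q₀ :=
    ((hA q₀ ⟨hq₀, hqU₁⟩).mono fun y hy => ⟨hy.1, hy.2.2⟩).clm_comp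
      (hMi.clm_comp (((hgs q₀ hqU).mono fun y hy => hy.2.1).clm_comp
        ((h.contDiffOn_proj q₀ hq₀).mono Set.inter_subset_left)))
  have hEq : ∀ y ∈ Q ∩ (U ∩ U₁),
      PH y = (A y).comp ((M y).inverse.comp ((fderiv ℝ g y).comp (P y))) := by
    intro y hy
    ext e
    have hyU : y ∈ Q ∩ U := ⟨hy.1, hy.2.1⟩
    obtain ⟨c, hc⟩ := (hAr y ⟨hy.1, hy.2.2⟩ _).1 (h.projH_mem hy.1 e)
    have h1 : fderiv ℝ g y (P y e) = M y c := by
      change _ = fderiv ℝ g y (A y c)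
      rw [hc, ← h.projH_proj hy.1, h.fderiv_chartExpr_projH hρ hyU (h.proj_mem hy.1 e)]
    have h2 : (M y).inverse (M y c) = c := by
      rw [← heM y hy, ContinuousLinearMap.inverse_equiv]
      exact (eM y hy).symm_apply_apply c
    change _ = A y ((M y).inverse (fderiv ℝ g y (P y e)))
    rw [h1, h2, hc]
  exact hRHS.congr hEq (hEq q₀ hq₀')

theorem contDiffOn_projV : ContDiffOn ℝ ∞ PV Q :=
  (h.contDiffOn_proj.sub h.contDiffOn_projH).congr fun _ hq => h.projV_eq hq

end Bundle

end IsHorizontalSplitting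

end Splitting

/-! ### The dual of the horizontal bundle -/

section Dual

open ContinuousLinearMap (adjoint)

variable {E : Type*} [NormedAddCommGroup E] [InnerProductSpace ℝ E] [FiniteDimensional ℝ E]
  {F B : Type*} [NormedAddCommGroup F] [NormedSpace ℝ F]
  [TopologicalSpace B] [ChartedSpace F B]

/-- Transposition, as a continuous linear map over the reals. -/
def adjointL (E : Type*) [NormedAddCommGroup E] [InnerProductSpace ℝ E] [FiniteDimensional ℝ E] :
    (E →L[ℝ] E) →L[ℝ] (E →L[ℝ] E) :=
  LinearMap.toContinuousLinearMap
    { toFun := fun A => adjoint A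
      map_add' := fun A B => map_add _ A B
      map_smul' := fun c A => by simp }

theorem finrank_submodule_prod {V W : Type*} [AddCommGroup V] [Module ℝ V] [AddCommGroup W]
    [Module ℝ W] [FiniteDimensional ℝ V] [FiniteDimensional ℝ W] (p : Submodule ℝ V)
    (r : Submodule ℝ W) :
    Module.finrank ℝ (p.prod r) = Module.finrank ℝ p + Module.finrank ℝ r := by
  have h1 : LinearMap.range (p.subtype.prodMap r.subtype) = p.prod r := by
    rw [LinearMap.range_prodMap, Submodule.range_subtype, Submodule.range_subtype]
  rw [← h1, LinearMap.finrank_range_of_inj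
    (Function.Injective.prodMap p.injective_subtype r.injective_subtype), Module.finrank_prod]

/-- The retraction of `E × E` onto the dual bundle induced by a retraction `ρ` onto `Q`. -/
def dualRetraction (PH : E → E →L[ℝ] E) (ρ : E → E) (x : E × E) : E × E :=
  (ρ x.1, adjoint (PH (ρ x.1)) x.2)

variable {d : ℕ} {Q : Set E} {f : E → B} {P : E → E →L[ℝ] E} {Hor : E → Submodule ℝ E}
  {PH PV : E → E →L[ℝ] E} {U : Set E} {ρ : E → E} {b₀ : B} {q p : E} {x : E × E}

namespace IsHorizontalSplitting

section Pointwise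

variable (h : IsHorizontalSplitting F d Q f P Hor PH PV)
include h

theorem mem_horizontalDual_iff (hq : q ∈ Q) :
    p ∈ horizontalDual PH q ↔ adjoint (PH q) p = p := by
  constructor
  · rintro ⟨r, rfl⟩
    refine ext_inner_right ℝ fun e => ?_
    change ⟪adjoint (PH q) (adjoint (PH q) r), e⟫_ℝ = ⟪adjoint (PH q) r, e⟫_ℝ
    rw [ContinuousLinearMap.adjoint_inner_left, ContinuousLinearMap.adjoint_inner_left,
      ContinuousLinearMap.adjoint_inner_left, h.projH_idem hq]
  · exact fun hp => ⟨p, hp⟩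

theorem inner_projH (hq : q ∈ Q) (hp : p ∈ horizontalDual PH q) (e : E) :
    ⟪p, PH q e⟫_ℝ = ⟪p, e⟫_ℝ := by
  rw [← ContinuousLinearMap.adjoint_inner_left, (h.mem_horizontalDual_iff hq).1 hp]

theorem adjoint_projH_idem (hq : q ∈ Q) (e : E) :
    adjoint (PH q) (adjoint (PH q) e) = adjoint (PH q) e :=
  (h.mem_horizontalDual_iff hq).1 ⟨e, rfl⟩

end Pointwise

theorem inner_horizontalPullback (w : CotangentSpace F B (f q)) (e : E) :
    ⟪horizontalPullback Q f PH q w, e⟫_ℝ = w (diffAlong (F := F) Q f q (PH q e)) := by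
  rw [horizontalPullback, ContinuousLinearMap.adjoint_inner_left,
    InnerProductSpace.toDual_symm_apply]
  rfl

section Geometry

variable [IsManifold 𝓘(ℝ, F) ∞ B] [FiniteDimensional ℝ F]
variable (h : IsHorizontalSplitting F d Q f P Hor PH PV)
include h

theorem finrank_hor (hq : q ∈ Q) : Module.finrank ℝ (Hor q) = Module.finrank ℝ F := by
  let D : E →ₗ[ℝ] F := (diffAlong (F := F) Q f q : E →L[ℝ] F).toLinearMap
  have hb := h.bijOn_diffAlong hq
  refine (LinearEquiv.ofBijective (D.comp (Hor q).subtype) ⟨?_, ?_⟩).finrank_eq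
  · exact fun a b hab => Subtype.ext (hb.injOn a.2 b.2 hab)
  · intro w
    obtain ⟨a, ha, haw⟩ := hb.surjOn (Set.mem_univ w)
    exact ⟨⟨a, ha⟩, haw⟩

theorem bijOn_horizontalPullback (hq : q ∈ Q) :
    Set.BijOn (horizontalPullback (F := F) Q f PH q) Set.univ (horizontalDual PH q) := by
  have hb := h.bijOn_diffAlong hq
  refine ⟨fun w _ => ⟨_, rfl⟩, ?_, ?_⟩
  · intro w _ w' _ hw
    refine ContinuousLinearMap.ext fun η => ?_
    obtain ⟨a, ha, rfl⟩ := hb.surjOn (Set.mem_univ η)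
    have h1 := inner_horizontalPullback (Q := Q) (PH := PH) w a
    have h2 := inner_horizontalPullback (Q := Q) (PH := PH) w' a
    rw [h.projH_of_mem_hor hq ha] at h1 h2
    exact (h1.symm.trans (congrArg (fun r => ⟪r, a⟫_ℝ) hw)).trans h2
  · intro p hp
    let D : E →ₗ[ℝ] F := (diffAlong (F := F) Q f q : E →L[ℝ] F).toLinearMap
    let e : Hor q ≃ₗ[ℝ] F := LinearEquiv.ofBijective (D.comp (Hor q).subtype)
      ⟨fun a b hab => Subtype.ext (hb.injOn a.2 b.2 hab), fun w =>
        let ⟨a, ha, haw⟩ := hb.surjOn (Set.mem_univ w)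
        ⟨⟨a, ha⟩, haw⟩⟩
    let w : F →L[ℝ] ℝ := LinearMap.toContinuousLinearMap
      ((innerSL ℝ p).toLinearMap.comp ((Hor q).subtype.comp e.symm.toLinearMap))
    refine ⟨w, Set.mem_univ _, ext_inner_right ℝ fun v => ?_⟩
    refine (inner_horizontalPullback (Q := Q) (PH := PH) (f := f) w v).trans ?_
    have h1 : e.symm (diffAlong (F := F) Q f q (PH q v)) = ⟨PH q v, h.projH_mem hq v⟩ := by
      exact e.symm_apply_apply ⟨PH q v, h.projH_mem hq v⟩
    change ⟪p, (e.symm (diffAlong (F := F) Q f q (PH q v)) : E)⟫_ℝ = _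
    rw [h1, h.inner_projH hq hp]

/-- The covector `w` in `f_{ℋ^*}(q, p) = (f q, w)` is given by `w(f'(q) a) = p . a` for `a` tangent
to `Q`. -/
theorem dualSubmersion_snd_apply (hx : x ∈ horizontalDualBundle Q PH) {a : E}
    (ha : a ∈ tangentSpaceOf Q x.1) :
    (dualSubmersion (F := F) Q f PH x).2 (diffAlong (F := F) Q f x.1 a) = ⟪x.2, a⟫_ℝ := by
  obtain ⟨w, -, hw⟩ := (h.bijOn_horizontalPullback hx.1).surjOn hx.2
  have h1 : horizontalPullback Q f PH x.1 (dualSubmersion (F := F) Q f PH x).2 = x.2 :=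
    Function.invFun_eq ⟨w, hw⟩
  have h2 := inner_horizontalPullback (Q := Q) (PH := PH) (q := x.1)
    (dualSubmersion (F := F) Q f PH x).2 a
  rw [h1, h.diffAlong_projH hx.1 ha] at h2
  exact h2.symm

theorem dualSubmersion_horizontalPullback (hq : q ∈ Q) (w : CotangentSpace F B (f q)) :
    dualSubmersion (F := F) Q f PH (q, horizontalPullback Q f PH q w) = ⟨f q, w⟩ := by
  have : Function.invFun (horizontalPullback Q f PH q) (horizontalPullback Q f PH q w) = w :=
    Function.leftInverse_invFun
      (Set.injOn_univ.1 (h.bijOn_horizontalPullback hq).injOn) w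
  simp only [dualSubmersion, this]

theorem image_dualSubmersion :
    dualSubmersion (F := F) Q f PH '' horizontalDualBundle Q PH =
      Bundle.TotalSpace.proj ⁻¹' (f '' Q) := by
  ext z
  constructor
  · rintro ⟨x, hx, rfl⟩
    exact ⟨x.1, hx.1, rfl⟩
  · obtain ⟨b, w⟩ := z
    rintro ⟨q, hq, hqb⟩
    change f q = b at hqb
    subst hqb
    exact ⟨(q, horizontalPullback (F := F) Q f PH q w),
      ⟨hq, (h.bijOn_horizontalPullback hq).mapsTo (Set.mem_univ w)⟩,
      h.dualSubmersion_horizontalPullback hq w⟩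

theorem contDiffOn_projH_comp (hρ : IsSmoothRetraction Q U ρ) :
    ContDiffOn ℝ ∞ (fun y => PH (ρ y)) U :=
  hρ.contDiffOn_comp h.contDiffOn_projH

theorem hasFDerivAt_projH_comp (hρ : IsSmoothRetraction Q U ρ) {y : E} (hy : y ∈ U) :
    HasFDerivAt (fun y => PH (ρ y)) (fderiv ℝ (fun y => PH (ρ y)) y) y :=
  (((h.contDiffOn_projH_comp hρ).contDiffAt (hρ.isOpen.mem_nhds hy)).differentiableAt
    (by simp)).hasFDerivAt

theorem hasFDerivWithinAt_projH (hq : q ∈ Q) :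
    HasFDerivWithinAt PH (fderivWithin ℝ PH Q q) Q q :=
  ((h.contDiffOn_projH q hq).differentiableWithinAt (by simp)).hasFDerivWithinAt

theorem isSmoothRetraction_dual (hρ : IsSmoothRetraction Q U ρ) :
    IsSmoothRetraction (horizontalDualBundle Q PH) (U ×ˢ Set.univ) (dualRetraction PH ρ) where
  isOpen := hρ.isOpen.prod isOpen_univ
  contDiffOn := by
    have h1 : ContDiffOn ℝ ∞ (fun x : E × E => ρ x.1) (U ×ˢ Set.univ) :=
      hρ.contDiffOn.comp contDiff_fst.contDiffOn fun x hx => hx.1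
    have h2 : ContDiffOn ℝ ∞ (fun x : E × E => PH (ρ x.1)) (U ×ˢ Set.univ) :=
      (h.contDiffOn_projH_comp hρ).comp contDiff_fst.contDiffOn fun x hx => hx.1
    exact h1.prodMk (((adjointL E).contDiff.comp_contDiffOn h2).clm_apply contDiff_snd.contDiffOn)
  mapsTo := fun x hx =>
    ⟨⟨(hρ.mapsTo hx.1).1, ⟨x.2, rfl⟩⟩, (hρ.mapsTo hx.1).2, Set.mem_univ _⟩
  eq_self := by
    rintro x ⟨hx, hxU, -⟩
    have h1 := hρ.eq_self x.1 ⟨hx.1, hxU⟩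
    refine Prod.ext h1 ?_
    change adjoint (PH (ρ x.1)) x.2 = x.2
    rw [h1, (h.mem_horizontalDual_iff hx.1).1 hx.2]

theorem fderiv_dualRetraction (hρ : IsSmoothRetraction Q U ρ)
    (hx : x ∈ horizontalDualBundle Q PH) (hxU : x.1 ∈ U) (ξ : E × E) :
    fderiv ℝ (dualRetraction PH ρ) x ξ = (fderiv ℝ ρ x.1 ξ.1,
      adjoint (PH x.1) ξ.2 + adjoint (fderiv ℝ (fun y => PH (ρ y)) x.1 ξ.1) x.2) := by
  have h1 : HasFDerivAt (fun x : E × E => ρ x.1) _ x :=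
    (hρ.hasFDerivAt hxU).comp x (hasFDerivAt_fst (𝕜 := ℝ))
  have h2 : HasFDerivAt (fun x : E × E => PH (ρ x.1)) _ x :=
    (h.hasFDerivAt_projH_comp hρ hxU).comp x (hasFDerivAt_fst (𝕜 := ℝ))
  have h3 := ((adjointL E).hasFDerivAt.comp x h2).clm_apply (hasFDerivAt_snd (𝕜 := ℝ) (p := x))
  have h4 := (h1.prodMk h3).fderiv
  have h5 := DFunLike.congr_fun h4 ξ
  refine h5.trans (Prod.ext rfl ?_)
  change adjoint (PH (ρ x.1)) ξ.2 + adjoint (fderiv ℝ (fun y => PH (ρ y)) x.1 ξ.1) x.2 = _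
  rw [hρ.eq_self x.1 ⟨hx.1, hxU⟩]

theorem fderivWithin_projH_apply (hρ : IsSmoothRetraction Q U ρ) (hq : q ∈ Q ∩ U) {a : E}
    (ha : a ∈ tangentSpaceOf Q q) :
    fderivWithin ℝ PH Q q a = fderiv ℝ (fun y => PH (ρ y)) q a :=
  hρ.hasFDerivWithinAt_apply hq (h.hasFDerivWithinAt_projH hq.1) ha

theorem mem_tangentSpaceOf_dual_iff (hx : x ∈ horizontalDualBundle Q PH) {ξ : E × E} :
    ξ ∈ tangentSpaceOf (horizontalDualBundle Q PH) x ↔ ξ.1 ∈ tangentSpaceOf Q x.1 ∧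
      ξ.2 = adjoint (PH x.1) ξ.2 + adjoint (fderivWithin ℝ PH Q x.1 ξ.1) x.2 := by
  obtain ⟨⟨U, ρ, hqU, hρ⟩, -⟩ := h.submanifold.exists_isSmoothRetraction hx.1
  have hq : x.1 ∈ Q ∩ U := ⟨hx.1, hqU⟩
  rw [(h.isSmoothRetraction_dual hρ).mem_tangentSpaceOf_iff ⟨hx, hqU, Set.mem_univ _⟩,
    h.fderiv_dualRetraction hρ hx hqU, Prod.ext_iff, hρ.mem_tangentSpaceOf_iff hq]
  refine and_congr_right fun h1 => ?_
  rw [h.fderivWithin_projH_apply hρ hq ((hρ.mem_tangentSpaceOf_iff hq).2 h1)]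
  exact eq_comm

theorem finrank_tangentSpaceOf_dual (hx : x ∈ horizontalDualBundle Q PH) :
    Module.finrank ℝ (tangentSpaceOf (horizontalDualBundle Q PH) x) =
      d + Module.finrank ℝ F := by
  obtain ⟨⟨U, ρ, hqU, hρ⟩, hd⟩ := h.submanifold.exists_isSmoothRetraction hx.1
  have hq : x.1 ∈ Q ∩ U := ⟨hx.1, hqU⟩
  have hR := h.isSmoothRetraction_dual hρ
  have h1 := (fderiv ℝ (dualRetraction PH ρ) x).toLinearMap.finrank_range_add_finrank_ker
  rw [hR.range_fderiv ⟨hx, hqU, Set.mem_univ _⟩] at h1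
  have h2 : LinearMap.ker (fderiv ℝ (dualRetraction PH ρ) x).toLinearMap =
      (LinearMap.ker (fderiv ℝ ρ x.1).toLinearMap).prod
        (LinearMap.ker (adjoint (PH x.1)).toLinearMap) := by
    ext ξ
    rw [LinearMap.mem_ker, Submodule.mem_prod, LinearMap.mem_ker, LinearMap.mem_ker]
    change fderiv ℝ (dualRetraction PH ρ) x ξ = 0 ↔
      fderiv ℝ ρ x.1 ξ.1 = 0 ∧ adjoint (PH x.1) ξ.2 = 0
    rw [h.fderiv_dualRetraction hρ hx hqU, Prod.ext_iff]
    refine and_congr_right fun h3 => ?_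
    change fderiv ℝ ρ x.1 ξ.1 = 0 at h3
    -- `PH ∘ ρ` is invariant under `ρ`, so its differential vanishes where that of `ρ` does.
    have h4 : fderiv ℝ (fun y => PH (ρ y)) x.1 ξ.1 = 0 := by
      have e1 := h.hasFDerivAt_projH_comp hρ (hρ.mapsTo hqU).2
      have e2 := e1.comp x.1 (hρ.hasFDerivAt hqU)
      have e3 : (fun y => PH (ρ y)) ∘ ρ =ᶠ[𝓝 x.1] fun y => PH (ρ y) := by
        filter_upwards [hρ.isOpen.mem_nhds hqU] with z hz
        rw [Function.comp_apply, hρ.idem hz]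
      have e4 := (e2.congr_of_eventuallyEq e3.symm).unique (h.hasFDerivAt_projH_comp hρ hqU)
      rw [← e4, ContinuousLinearMap.comp_apply, h3, map_zero]
    rw [h4, map_zero]
    simp
  rw [h2, finrank_submodule_prod, ← ContinuousLinearMap.orthogonal_range, h.range_projH hx.1,
    Module.finrank_prod] at h1
  have h3 := (fderiv ℝ ρ x.1).toLinearMap.finrank_range_add_finrank_ker
  rw [hρ.range_fderiv hq, hd] at h3
  have h4 := (Hor x.1).finrank_add_finrank_orthogonal
  rw [h.finrank_hor hx.1] at h4
  omega

theorem isEmbeddedSubmanifold_dual :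
    IsEmbeddedSubmanifold (d + Module.finrank ℝ F) (horizontalDualBundle Q PH) := by
  refine isEmbeddedSubmanifold_of_isSmoothRetraction fun x hx => ?_
  obtain ⟨⟨U, ρ, hqU, hρ⟩, -⟩ := h.submanifold.exists_isSmoothRetraction hx.1
  exact ⟨U ×ˢ Set.univ, dualRetraction PH ρ, ⟨hqU, Set.mem_univ x.2⟩, h.isSmoothRetraction_dual hρ,
    h.finrank_tangentSpaceOf_dual hx⟩

end Geometry

end IsHorizontalSplitting

end Dual

/-! ### The induced map to the cotangent bundle -/

section DualSubmersion

open ContinuousLinearMap (adjoint)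

variable {E : Type*} [NormedAddCommGroup E] [InnerProductSpace ℝ E] [FiniteDimensional ℝ E]
  {F B : Type*} [NormedAddCommGroup F] [NormedSpace ℝ F] [FiniteDimensional ℝ F]
  [TopologicalSpace B] [ChartedSpace F B] [IsManifold 𝓘(ℝ, F) ∞ B]

variable {d : ℕ} {Q : Set E} {f : E → B} {P : E → E →L[ℝ] E} {Hor : E → Submodule ℝ E}
  {PH PV : E → E →L[ℝ] E} {U : Set E} {ρ : E → E} {b₀ : B} {q p : E} {x : E × E}

omit [FiniteDimensional ℝ E] [FiniteDimensional ℝ F] [IsManifold 𝓘(ℝ, F) ∞ B] in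
theorem IsAdaptedRetraction.exists_restrict (hρ : IsAdaptedRetraction (F := F) Q f b₀ U ρ)
    {O : Set E} (hO : IsOpen O) (hq : q ∈ Q ∩ U) (hqO : q ∈ O) :
    ∃ U' ⊆ U ∩ O, q ∈ U' ∧ IsAdaptedRetraction (F := F) Q f b₀ U' ρ := by
  obtain ⟨U', hU', hqU', h'⟩ := hρ.toIsSmoothRetraction.exists_restrict hO hq hqO
  exact ⟨U', hU', hqU', h', fun y hy => hρ.mem_source y (hU' hy).1,
    hρ.contDiffOn_chartExpr.mono fun y hy => (hU' hy).1⟩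

namespace IsHorizontalSplitting

variable (h : IsHorizontalSplitting F d Q f P Hor PH PV)
include h

/-- In the chart of the cotangent bundle over the chart at `f q₀`, the covector component of
`f_{ℋ^*}` extends to a smooth map `σ`, which is characterized by `σ(q, p) (Dg(q) a) = p . a` for `a`
tangent to `Q`, where `g` is `f ∘ ρ` in the chart. With `R₀` a right inverse of `Dg(q₀)` and
`Λ = Dg (PH ∘ ρ)`, it is `σ(q, p) = p . R₀ (Λ(q) R₀)⁻¹`. -/
theorem exists_chart_dualSubmersion {q₀ : E} (hq₀ : q₀ ∈ Q) :
    ∃ (U : Set E) (ρ : E → E) (σ : E × E → F →L[ℝ] ℝ), q₀ ∈ U ∧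
      IsAdaptedRetraction (F := F) Q f (f q₀) U ρ ∧ ContDiffOn ℝ ∞ σ (U ×ˢ Set.univ) ∧
      ∀ x ∈ horizontalDualBundle Q PH, x.1 ∈ U →
        (∀ a ∈ tangentSpaceOf Q x.1,
          σ x (fderiv ℝ (chartExpr (F := F) f ρ (f q₀)) x.1 a) = ⟪x.2, a⟫_ℝ) ∧
        ((dualSubmersion (F := F) Q f PH x).2 : TangentSpace 𝓘(ℝ, F) (f x.1) →L[ℝ] ℝ).comp
          (chartFrame (F := F) (f q₀) (f x.1)) = σ x := by
  obtain ⟨U, ρ, hqU, hρ⟩ := h.exists_isAdaptedRetraction hq₀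
  have hq₀U : q₀ ∈ Q ∩ U := ⟨hq₀, hqU⟩
  set g := chartExpr (F := F) f ρ (f q₀) with hg
  obtain ⟨R, hR⟩ := (fderiv ℝ g q₀).toLinearMap.exists_rightInverse_of_surjective
    (LinearMap.range_eq_top.2 fun w =>
      let ⟨a, _, ha⟩ := h.exists_mem_hor_fderiv_eq hρ hq₀U w
      ⟨a, ha⟩)
  -- composing with the horizontal projection makes the right inverse horizontal at `q₀`
  let R₀ : F →L[ℝ] E := (fderiv ℝ ρ q₀).comp R.toContinuousLinearMap
  have hR₀ : ∀ c, fderiv ℝ g q₀ (PH q₀ (R₀ c)) = c := by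
    intro c
    change fderiv ℝ g q₀ (PH q₀ (fderiv ℝ ρ q₀ (R c))) = c
    rw [h.fderiv_chartExpr_projH hρ hq₀U (hρ.fderiv_mem hq₀U _)]
    have h1 := hρ.fderiv_chartExpr_comp hqU (R c)
    rw [hρ.eq_self q₀ hq₀U] at h1
    exact h1.trans (DFunLike.congr_fun hR c)
  let M : E → F →L[ℝ] F := fun y => (fderiv ℝ g y).comp ((PH (ρ y)).comp R₀)
  have hM : ContDiffOn ℝ ∞ M U :=
    (hρ.contDiffOn_chartExpr.fderiv_of_isOpen hρ.isOpen (by simp)).clm_comp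
      ((h.contDiffOn_projH_comp hρ.toIsSmoothRetraction).clm_comp contDiffOn_const)
  let O : Set E := U ∩ M ⁻¹' Set.range ContinuousLinearEquiv.toContinuousLinearMap
  have hO : IsOpen O := hM.continuousOn.isOpen_inter_preimage hρ.isOpen ContinuousLinearEquiv.isOpen
  have hq₀O : q₀ ∈ O := by
    refine ⟨hqU, ContinuousLinearEquiv.refl ℝ F, ?_⟩
    ext1 c
    change c = fderiv ℝ g q₀ (PH (ρ q₀) (R₀ c))
    rw [hρ.eq_self q₀ hq₀U, hR₀]
  obtain ⟨U', hU', hq₀U', hρ'⟩ := hρ.exists_restrict hO hq₀U hq₀O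
  have hMi : ContDiffOn ℝ ∞ (fun y => (M y).inverse) U' := by
    intro y hy
    obtain ⟨-, hyU, e, he⟩ := hU' hy
    have h1 := contDiffAt_map_inverse (n := ∞) e
    have he' : (e : F →L[ℝ] F) = M y := he
    rw [he'] at h1
    exact h1.comp_contDiffWithinAt y ((hM y hyU).mono fun z hz => (hU' hz).1)
  let σ : E × E → F →L[ℝ] ℝ := fun x => (innerSL ℝ x.2).comp (R₀.comp (M x.1).inverse)
  have key : ∀ x ∈ horizontalDualBundle Q PH, x.1 ∈ U' → ∀ a ∈ tangentSpaceOf Q x.1,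
      σ x (fderiv ℝ g x.1 a) = ⟪x.2, a⟫_ℝ := by
    intro x hx hxU a ha
    have hxU₀ : x.1 ∈ Q ∩ U := ⟨hx.1, (hU' hxU).1⟩
    obtain ⟨-, -, e, he⟩ := hU' hxU
    have he' : M x.1 = (e : F →L[ℝ] F) := he.symm
    have h1 : ∃ c, c = (M x.1).inverse (fderiv ℝ g x.1 a) := ⟨_, rfl⟩
    obtain ⟨c, hc⟩ := h1
    have h2 : fderiv ℝ g x.1 (PH x.1 (R₀ c)) = fderiv ℝ g x.1 a := by
      have : M x.1 c = fderiv ℝ g x.1 a := by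
        rw [hc, he', ContinuousLinearMap.inverse_equiv]
        exact e.apply_symm_apply _
      rw [← this]
      change _ = fderiv ℝ g x.1 (PH (ρ x.1) (R₀ c))
      rw [hρ.eq_self _ hxU₀]
    have h3 : PH x.1 (R₀ c) = PH x.1 a := by
      have h4 : PH x.1 (R₀ c) - PH x.1 a ∈ Hor x.1 :=
        Submodule.sub_mem _ (h.projH_mem hx.1 _) (h.projH_mem hx.1 _)
      refine sub_eq_zero.1 (h.eq_zero_of_mem hx.1 h4 ?_)
      rw [← h.fderiv_chartExpr_eq_zero_iff hρ hxU₀ (h.hor_le hx.1 h4), map_sub, h2,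
        h.fderiv_chartExpr_projH hρ hxU₀ ha, sub_self]
    change ⟪x.2, R₀ ((M x.1).inverse (fderiv ℝ g x.1 a))⟫_ℝ = _
    rw [← hc, ← h.inner_projH hx.1 hx.2, h3, h.inner_projH hx.1 hx.2]
  refine ⟨U', ρ, σ, hq₀U', hρ', ?_, fun x hx hxU => ⟨key x hx hxU, ?_⟩⟩
  · exact ((innerSL ℝ).contDiff.comp_contDiffOn contDiff_snd.contDiffOn).clm_comp
      (contDiffOn_const.clm_comp (hMi.comp contDiff_fst.contDiffOn fun x hx => hx.1))
  · ext w
    obtain ⟨a, ha, rfl⟩ := h.exists_mem_hor_fderiv_eq hρ' ⟨hx.1, hxU⟩ w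
    have haT := h.hor_le hx.1 ha
    refine Eq.trans ?_ (key x hx hxU a haT).symm
    refine Eq.trans ?_ (h.dualSubmersion_snd_apply hx haT)
    exact congrArg (dualSubmersion (F := F) Q f PH x).2
      (h.chartFrame_fderiv hρ' ⟨hx.1, hxU⟩ haT)

theorem contMDiffOn_dualSubmersion :
    ContMDiffOn 𝓘(ℝ, E × E) (cotangentModel F) ∞ (dualSubmersion (F := F) Q f PH)
      (horizontalDualBundle Q PH) := by
  intro x₀ hx₀
  obtain ⟨U, ρ, σ, hqU, hρ, hσ, hchart⟩ := h.exists_chart_dualSubmersion hx₀.1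
  refine Bundle.contMDiffWithinAt_totalSpace.2 ⟨?_, ?_⟩
  · exact (h.submersion.1 x₀.1 hx₀.1).comp x₀
      (contMDiffWithinAt_iff_contDiffWithinAt.2 contDiff_fst.contDiffWithinAt) fun x hx => hx.1
  · have hU : U ×ˢ Set.univ ∈ 𝓝 x₀ := (hρ.isOpen.prod isOpen_univ).mem_nhds ⟨hqU, Set.mem_univ _⟩
    rw [contMDiffWithinAt_iff_contDiffWithinAt]
    refine ((hσ.contDiffAt hU).contDiffWithinAt (s := horizontalDualBundle Q PH)).congr_of_eventuallyEq
      ?_ ?_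
    · filter_upwards [self_mem_nhdsWithin, mem_nhdsWithin_of_mem_nhds hU] with x hx hxU
      rw [trivializationAt_cotangent_apply]
      exact (hchart x hx hxU.1).2
    · rw [trivializationAt_cotangent_apply]
      exact (hchart x₀ hx₀ hqU).2

theorem hasMFDerivWithinAt_dualSubmersion (hx : x ∈ horizontalDualBundle Q PH) :
    HasMFDerivWithinAt 𝓘(ℝ, E × E) (cotangentModel F) (dualSubmersion (F := F) Q f PH)
      (horizontalDualBundle Q PH) x (dualSubmersionDiff (F := F) Q f PH x) :=
  ((h.contMDiffOn_dualSubmersion x hx).mdifferentiableWithinAt (by simp)).hasMFDerivWithinAt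

/-- The differential of `f_{ℋ^*}` at `x₀`, written in the chart at the image of `x₀`. -/
theorem exists_fderiv_dualSubmersion {x₀ : E × E} (hx₀ : x₀ ∈ horizontalDualBundle Q PH) :
    ∃ (U : Set E) (ρ : E → E) (σ : E × E → F →L[ℝ] ℝ), x₀.1 ∈ U ∧
      IsAdaptedRetraction (F := F) Q f (f x₀.1) U ρ ∧ ContDiffOn ℝ ∞ σ (U ×ˢ Set.univ) ∧
      (∀ x ∈ horizontalDualBundle Q PH, x.1 ∈ U → ∀ a ∈ tangentSpaceOf Q x.1,
          σ x (fderiv ℝ (chartExpr (F := F) f ρ (f x₀.1)) x.1 a) = ⟪x.2, a⟫_ℝ) ∧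
      ∀ ξ ∈ tangentSpaceOf (horizontalDualBundle Q PH) x₀,
        dualSubmersionDiff (F := F) Q f PH x₀ ξ =
          ((fderiv ℝ (chartExpr (F := F) f ρ (f x₀.1)) x₀.1 ξ.1,
            fderiv ℝ (σ ∘ dualRetraction PH ρ) x₀ ξ) : F × (F →L[ℝ] ℝ)) := by
  obtain ⟨U, ρ, σ, hqU, hρ, hσ, hchart⟩ := h.exists_chart_dualSubmersion hx₀.1
  refine ⟨U, ρ, σ, hqU, hρ, hσ, fun x hx hxU => (hchart x hx hxU).1, fun ξ hξ => ?_⟩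
  have hxU : x₀ ∈ U ×ˢ (Set.univ : Set E) := ⟨hqU, Set.mem_univ _⟩
  have hU : U ×ˢ (Set.univ : Set E) ∈ 𝓝 x₀ := (hρ.isOpen.prod isOpen_univ).mem_nhds hxU
  let z₀ := dualSubmersion (F := F) Q f PH x₀
  let κ : E × E → F × (F →L[ℝ] ℝ) := fun x => (chartExpr (F := F) f ρ (f x₀.1) x.1, σ x)
  have hκ : ∀ x ∈ horizontalDualBundle Q PH, x ∈ U ×ˢ (Set.univ : Set E) →
      extChartAt (cotangentModel F) z₀ (dualSubmersion (F := F) Q f PH x) = κ x := by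
    intro x hx hxU
    rw [extChartAt_cotangent_apply]
    refine Prod.ext ?_ (hchart x hx hxU.1).2
    change _ = extChartAt 𝓘(ℝ, F) (f x₀.1) (f (ρ x.1))
    rw [hρ.eq_self x.1 ⟨hx.1, hxU.1⟩]
    rfl
  let D : E × E →L[ℝ] F × (F →L[ℝ] ℝ) := dualSubmersionDiff (F := F) Q f PH x₀
  have h1 : HasFDerivWithinAt κ D (horizontalDualBundle Q PH) x₀ := by
    have h2 : HasFDerivWithinAt (fun x => extChartAt (cotangentModel F) z₀
        (dualSubmersion (F := F) Q f PH x)) D (horizontalDualBundle Q PH) x₀ := by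
      have : HasFDerivWithinAt (fun x => extChartAt (cotangentModel F) z₀
          (dualSubmersion (F := F) Q f PH x)) D ((extChartAt 𝓘(ℝ, E × E) x₀).symm ⁻¹'
            horizontalDualBundle Q PH ∩ Set.range 𝓘(ℝ, E × E)) x₀ :=
        (h.hasMFDerivWithinAt_dualSubmersion hx₀).2
      exact this.mono fun y hy => ⟨hy, y, rfl⟩
    refine h2.congr_of_eventuallyEq ?_ (hκ x₀ hx₀ hxU).symm
    filter_upwards [self_mem_nhdsWithin, mem_nhdsWithin_of_mem_nhds hU] with x hx hxU
    exact (hκ x hx hxU).symm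
  have hR := h.isSmoothRetraction_dual hρ.toIsSmoothRetraction
  have h3 : D ξ = fderiv ℝ (κ ∘ dualRetraction PH ρ) x₀ ξ :=
    hR.hasFDerivWithinAt_apply ⟨hx₀, hxU⟩ h1 hξ
  have h4 : HasFDerivAt (κ ∘ dualRetraction PH ρ)
      (((fderiv ℝ (chartExpr (F := F) f ρ (f x₀.1)) x₀.1).comp
        (ContinuousLinearMap.fst ℝ E E)).prod (fderiv ℝ (σ ∘ dualRetraction PH ρ) x₀)) x₀ := by
    have h5 : HasFDerivAt (σ ∘ dualRetraction PH ρ) (fderiv ℝ (σ ∘ dualRetraction PH ρ) x₀) x₀ :=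
      (((hσ.comp hR.contDiffOn fun x hx => (hR.mapsTo hx).2).contDiffAt hU).differentiableAt
        (by simp)).hasFDerivAt
    have h6 : HasFDerivAt (fun x : E × E => chartExpr (F := F) f ρ (f x₀.1) x.1)
        ((fderiv ℝ (chartExpr (F := F) f ρ (f x₀.1)) x₀.1).comp
        (ContinuousLinearMap.fst ℝ E E)) x₀ :=
      (hρ.hasFDerivAt_chartExpr hqU).comp x₀ hasFDerivAt_fst
    refine (h6.prodMk h5).congr_of_eventuallyEq ?_
    filter_upwards [hU] with x hx
    exact Prod.ext (hρ.chartExpr_retraction hx.1) rfl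
  rw [h4.fderiv] at h3
  exact h3

/-- The first component of the differential of `f_{ℋ^*}` is the differential of `f`. -/
theorem dualSubmersionDiff_fst (hx : x ∈ horizontalDualBundle Q PH) {ξ : E × E}
    (hξ : ξ ∈ tangentSpaceOf (horizontalDualBundle Q PH) x) :
    (dualSubmersionDiff (F := F) Q f PH x ξ : F × (F →L[ℝ] ℝ)).1 =
      (diffAlong (F := F) Q f x.1 ξ.1 : F) := by
  obtain ⟨U, ρ, σ, hqU, hρ, -, -, hD⟩ := h.exists_fderiv_dualSubmersion hx
  have h1 := h.chartFrame_fderiv hρ ⟨hx.1, hqU⟩ ((h.mem_tangentSpaceOf_dual_iff hx).1 hξ).1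
  rw [chartFrame_self] at h1
  exact (congrArg Prod.fst (hD ξ hξ)).trans h1

/-- The identity `σ(q, p) ∘ Dg(q) = p . Dρ(q)` says that `f_{ℋ^*}` pulls back the tautological form
to the Poincaré form `p . dq`. Differentiating it, and using that second derivatives are symmetric,
shows that `f_{ℋ^*}` is presymplectic. -/
theorem cotangentSymplectic_dualSubmersionDiff (hx : x ∈ horizontalDualBundle Q PH) {ξ η : E × E}
    (hξ : ξ ∈ tangentSpaceOf (horizontalDualBundle Q PH) x)
    (hη : η ∈ tangentSpaceOf (horizontalDualBundle Q PH) x) :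
    cotangentSymplectic (dualSubmersion (F := F) Q f PH x)
      (dualSubmersionDiff Q f PH x ξ) (dualSubmersionDiff Q f PH x η) = poincareForm ξ η := by
  obtain ⟨U, ρ, σ, hqU, hρ, hσ, hpair, hD⟩ := h.exists_fderiv_dualSubmersion hx
  set g := chartExpr (F := F) f ρ (f x.1) with hg
  have hxU : x ∈ U ×ˢ (Set.univ : Set E) := ⟨hqU, Set.mem_univ _⟩
  have hU : U ×ˢ (Set.univ : Set E) ∈ 𝓝 x := (hρ.isOpen.prod isOpen_univ).mem_nhds hxU
  have hR := h.isSmoothRetraction_dual hρ.toIsSmoothRetraction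
  set W := σ ∘ dualRetraction PH ρ with hW
  have hWd : HasFDerivAt W (fderiv ℝ W x) x :=
    (((hσ.comp hR.contDiffOn fun x hx => (hR.mapsTo hx).2).contDiffAt hU).differentiableAt
      (by simp)).hasFDerivAt
  have hgd : HasFDerivAt (fderiv ℝ g) (fderiv ℝ (fderiv ℝ g) x.1) x.1 :=
    (((hρ.contDiffOn_chartExpr.fderiv_of_isOpen (m := ∞) hρ.isOpen (by simp)).contDiffAt
      (hρ.isOpen.mem_nhds hqU)).differentiableAt (by simp)).hasFDerivAt
  have hρd : HasFDerivAt (fderiv ℝ ρ) (fderiv ℝ (fderiv ℝ ρ) x.1) x.1 :=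
    (((hρ.contDiffOn.fderiv_of_isOpen (m := ∞) hρ.isOpen (by simp)).contDiffAt
      (hρ.isOpen.mem_nhds hqU)).differentiableAt (by simp)).hasFDerivAt
  have hgsymm : IsSymmSndFDerivAt ℝ g x.1 :=
    (hρ.contDiffOn_chartExpr.contDiffAt (hρ.isOpen.mem_nhds hqU)).isSymmSndFDerivAt
      (by rw [minSmoothness_of_isRCLikeNormedField]; exact ENat.LEInfty.out)
  have hρsymm : IsSymmSndFDerivAt ℝ ρ x.1 :=
    (hρ.contDiffOn.contDiffAt (hρ.isOpen.mem_nhds hqU)).isSymmSndFDerivAt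
      (by rw [minSmoothness_of_isRCLikeNormedField]; exact ENat.LEInfty.out)
  have hfix : dualRetraction PH ρ x = x := hR.eq_self x ⟨hx, hxU⟩
  have hpt : ∀ y ∈ U ×ˢ (Set.univ : Set E), ∀ a,
      W y (fderiv ℝ g y.1 a) = ⟪(dualRetraction PH ρ y).2, fderiv ℝ ρ y.1 a⟫_ℝ := by
    intro y hy a
    rw [← hρ.fderiv_chartExpr_comp hy.1]
    refine hpair _ (hR.mapsTo hy).1 (hρ.mapsTo hy.1).2 _ ?_
    exact hρ.toIsSmoothRetraction.fderiv_mem_of_mem hy.1 a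
  have key : ∀ ζ ∈ tangentSpaceOf (horizontalDualBundle Q PH) x, ∀ a,
      fderiv ℝ W x ζ (fderiv ℝ g x.1 a) + W x (fderiv ℝ (fderiv ℝ g) x.1 ζ.1 a) =
      ⟪ζ.2, fderiv ℝ ρ x.1 a⟫_ℝ + ⟪x.2, fderiv ℝ (fderiv ℝ ρ) x.1 ζ.1 a⟫_ℝ := by
    intro ζ hζ a
    have h1 : HasFDerivAt (fun y : E × E => fderiv ℝ g y.1 a) _ x :=
      ((hgd.comp x (hasFDerivAt_fst (𝕜 := ℝ))).clm_apply (hasFDerivAt_const a x))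
    have h2 : HasFDerivAt (fun y : E × E => fderiv ℝ ρ y.1 a) _ x :=
      ((hρd.comp x (hasFDerivAt_fst (𝕜 := ℝ))).clm_apply (hasFDerivAt_const a x))
    have h3 := hWd.clm_apply h1
    have h4 := ((hR.hasFDerivAt hxU).snd).inner ℝ h2
    have h5 : (fun y : E × E => W y (fderiv ℝ g y.1 a)) =ᶠ[𝓝 x]
        fun y => ⟪(dualRetraction PH ρ y).2, fderiv ℝ ρ y.1 a⟫_ℝ := by
      filter_upwards [hU] with y hy using hpt y hy a
    have h6 := DFunLike.congr_fun (h3.unique (h4.congr_of_eventuallyEq h5)) ζ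
    have h7 : fderiv ℝ (dualRetraction PH ρ) x ζ = ζ :=
      (hR.mem_tangentSpaceOf_iff ⟨hx, hxU⟩).1 hζ
    simp [h7, hfix] at h6
    linarith
  have hξT := (h.mem_tangentSpaceOf_dual_iff hx).1 hξ
  have hηT := (h.mem_tangentSpaceOf_dual_iff hx).1 hη
  have hq : x.1 ∈ Q ∩ U := ⟨hx.1, hqU⟩
  have k1 := key ξ hξ η.1
  have k2 := key η hη ξ.1
  rw [(hρ.mem_tangentSpaceOf_iff hq).1 hηT.1, hgsymm.eq ξ.1 η.1, hρsymm.eq ξ.1 η.1] at k1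
  rw [(hρ.mem_tangentSpaceOf_iff hq).1 hξT.1] at k2
  rw [hD ξ hξ, hD η hη]
  refine (cotangentSymplectic_apply _ _ _).trans ?_
  change fderiv ℝ W x η (fderiv ℝ g x.1 ξ.1) - fderiv ℝ W x ξ (fderiv ℝ g x.1 η.1) = _
  rw [poincareForm, real_inner_comm]
  linarith

end IsHorizontalSplitting

end DualSubmersion

/-! ### Vertical and horizontal vectors of the dual bundle -/

section DualVectors

open ContinuousLinearMap (adjoint)

theorem IsSmoothRetraction.fderivWithin_idem {V W : Type*} [NormedAddCommGroup V] [NormedSpace ℝ V]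
    [NormedAddCommGroup W] [NormedSpace ℝ W] {S U : Set V} {ρ : V → V}
    (hρ : IsSmoothRetraction S U ρ) {q : V} (hq : q ∈ S ∩ U) {A : V → W →L[ℝ] W}
    (hA : ContDiffOn ℝ ∞ A S) (hid : ∀ y ∈ S, (A y).comp (A y) = A y) {Δ : V}
    (hΔ : Δ ∈ tangentSpaceOf S q) (e : W) :
    A q (fderivWithin ℝ A S q Δ e) + fderivWithin ℝ A S q Δ (A q e) =
      fderivWithin ℝ A S q Δ e := by
  have h1 : HasFDerivWithinAt A (fderivWithin ℝ A S q) S q :=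
    ((hA q hq.1).differentiableWithinAt (by simp)).hasFDerivWithinAt
  have h2 := h1.clm_comp h1
  have h3 := h2.congr (fun y hy => (hid y hy).symm) (hid q hq.1).symm
  have h4 := (hρ.hasFDerivWithinAt_apply hq h3 hΔ).trans
    (hρ.hasFDerivWithinAt_apply hq h1 hΔ).symm
  exact DFunLike.congr_fun h4 e

variable {E : Type*} [NormedAddCommGroup E] [InnerProductSpace ℝ E] [FiniteDimensional ℝ E]
  {F B : Type*} [NormedAddCommGroup F] [NormedSpace ℝ F] [FiniteDimensional ℝ F]
  [TopologicalSpace B] [ChartedSpace F B] [IsManifold 𝓘(ℝ, F) ∞ B]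

variable {d : ℕ} {Q : Set E} {f : E → B} {P : E → E →L[ℝ] E} {Hor : E → Submodule ℝ E}
  {PH PV : E → E →L[ℝ] E} {q Δ e : E} {x ξ η : E × E}

/-- The differential of `f_{ℋ^*}` along `ℋ^*`, in the chart of the cotangent bundle at the image. -/
def dualDiff (F : Type*) [NormedAddCommGroup F] [NormedSpace ℝ F] [ChartedSpace F B]
    [IsManifold 𝓘(ℝ, F) ∞ B] (Q : Set E) (f : E → B) (PH : E → E →L[ℝ] E) (x : E × E) :
    E × E →L[ℝ] F × (F →L[ℝ] ℝ) :=
  dualSubmersionDiff (F := F) Q f PH x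

namespace IsHorizontalSplitting

variable (h : IsHorizontalSplitting F d Q f P Hor PH PV)
include h

theorem fderivWithin_projH_of_mem_hor (hq : q ∈ Q) (hΔ : Δ ∈ tangentSpaceOf Q q) (he : e ∈ Hor q) :
    PH q (fderivWithin ℝ PH Q q Δ e) = 0 := by
  obtain ⟨⟨U, ρ, hqU, hρ⟩, -⟩ := h.submanifold.exists_isSmoothRetraction hq
  have := hρ.fderivWithin_idem ⟨hq, hqU⟩ h.contDiffOn_projH
    (fun y hy => ContinuousLinearMap.ext (h.projH_idem hy)) hΔ e
  rw [h.projH_of_mem_hor hq he] at this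
  exact add_eq_right.1 this

/-- On vertical vectors the derivatives of `PH` and `PV` cancel against `ℋ^*`, because `P = PH + PV`
is idempotent. -/
theorem inner_fderivWithin_projV (hx : x ∈ horizontalDualBundle Q PH)
    (hΔ : Δ ∈ tangentSpaceOf Q x.1) (he : e ∈ verticalSpace Q f x.1) :
    ⟪x.2, fderivWithin ℝ PV Q x.1 Δ e⟫_ℝ = -⟪x.2, fderivWithin ℝ PH Q x.1 Δ e⟫_ℝ := by
  obtain ⟨⟨U, ρ, hqU, hρ⟩, -⟩ := h.submanifold.exists_isSmoothRetraction hx.1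
  have hq : x.1 ∈ Q ∩ U := ⟨hx.1, hqU⟩
  have h1 := hρ.fderivWithin_idem hq h.contDiffOn_proj h.proj_idem hΔ e
  rw [h.proj_apply_of_mem hx.1 (h.vert_le hx.1 he)] at h1
  have h2 : P x.1 (fderivWithin ℝ P Q x.1 Δ e) = 0 := add_eq_right.1 h1
  have h3 : ⟪x.2, fderivWithin ℝ P Q x.1 Δ e⟫_ℝ = 0 := by
    rw [← h.inner_projH hx.1 hx.2, ← h.projH_proj hx.1, h2, map_zero, inner_zero_right]
  have hP : HasFDerivWithinAt P (fderivWithin ℝ P Q x.1) Q x.1 :=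
    ((h.contDiffOn_proj x.1 hx.1).differentiableWithinAt (by simp)).hasFDerivWithinAt
  have hV : HasFDerivWithinAt PV (fderivWithin ℝ PV Q x.1) Q x.1 :=
    ((h.contDiffOn_projV x.1 hx.1).differentiableWithinAt (by simp)).hasFDerivWithinAt
  have hV' : HasFDerivWithinAt PV (fderivWithin ℝ P Q x.1 - fderivWithin ℝ PH Q x.1) Q x.1 :=
    (hP.sub (h.hasFDerivWithinAt_projH hx.1)).congr (fun y hy => h.projV_eq hy) (h.projV_eq hx.1)
  have h4 := (hρ.hasFDerivWithinAt_apply hq hV hΔ).trans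
    (hρ.hasFDerivWithinAt_apply hq hV' hΔ).symm
  rw [h4]
  change ⟪x.2, fderivWithin ℝ P Q x.1 Δ e - fderivWithin ℝ PH Q x.1 Δ e⟫_ℝ = _
  rw [inner_sub_right, h3, zero_sub]

theorem inner_fderivWithin_projH_of_mem_hor (hx : x ∈ horizontalDualBundle Q PH)
    (hΔ : Δ ∈ tangentSpaceOf Q x.1) (he : e ∈ Hor x.1) :
    ⟪x.2, fderivWithin ℝ PH Q x.1 Δ e⟫_ℝ = 0 := by
  rw [← h.inner_projH hx.1 hx.2, h.fderivWithin_projH_of_mem_hor hx.1 hΔ he, inner_zero_right]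

theorem adjoint_projH_adjoint_fderivWithin (hx : x ∈ horizontalDualBundle Q PH)
    (hΔ : Δ ∈ tangentSpaceOf Q x.1) :
    adjoint (PH x.1) (adjoint (fderivWithin ℝ PH Q x.1 Δ) x.2) = 0 := by
  refine ext_inner_right ℝ fun e => ?_
  rw [ContinuousLinearMap.adjoint_inner_left, ContinuousLinearMap.adjoint_inner_left,
    h.inner_fderivWithin_projH_of_mem_hor hx hΔ (h.projH_mem hx.1 e), inner_zero_left]

/-- Every tangent vector of `Q` lifts to a tangent vector of `ℋ^*`. -/
theorem lift_mem_tangentSpaceOf_dual (hx : x ∈ horizontalDualBundle Q PH)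
    (hΔ : Δ ∈ tangentSpaceOf Q x.1) :
    ((Δ, adjoint (fderivWithin ℝ PH Q x.1 Δ) x.2) : E × E) ∈
      tangentSpaceOf (horizontalDualBundle Q PH) x := by
  rw [h.mem_tangentSpaceOf_dual_iff hx]
  refine ⟨hΔ, ?_⟩
  change _ = adjoint (PH x.1) (adjoint (fderivWithin ℝ PH Q x.1 Δ) x.2) + _
  rw [h.adjoint_projH_adjoint_fderivWithin hx hΔ, zero_add]

theorem mem_dualHorizontal_iff (hx : x ∈ horizontalDualBundle Q PH) :
    ξ ∈ dualHorizontal Q Hor PH x ↔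
      ξ ∈ tangentSpaceOf (horizontalDualBundle Q PH) x ∧ ξ.1 ∈ Hor x.1 := by
  rw [h.mem_tangentSpaceOf_dual_iff hx]
  exact ⟨fun hξ => ⟨⟨h.hor_le hx.1 hξ.1, hξ.2⟩, hξ.1⟩, fun hξ => ⟨hξ.2, hξ.1.2⟩⟩

theorem dualDiff_fst (hx : x ∈ horizontalDualBundle Q PH)
    (hξ : ξ ∈ tangentSpaceOf (horizontalDualBundle Q PH) x) :
    (dualDiff F Q f PH x ξ).1 = (diffAlong (F := F) Q f x.1 ξ.1 : F) :=
  h.dualSubmersionDiff_fst hx hξ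

theorem dualDiff_symplectic (hx : x ∈ horizontalDualBundle Q PH)
    (hξ : ξ ∈ tangentSpaceOf (horizontalDualBundle Q PH) x)
    (hη : η ∈ tangentSpaceOf (horizontalDualBundle Q PH) x) :
    (dualDiff F Q f PH x η).2 (dualDiff F Q f PH x ξ).1 -
      (dualDiff F Q f PH x ξ).2 (dualDiff F Q f PH x η).1 = poincareForm ξ η :=
  (cotangentSymplectic_apply _ _ _).symm.trans (h.cotangentSymplectic_dualSubmersionDiff hx hξ hη)

theorem exists_lift (hx : x ∈ horizontalDualBundle Q PH) (w : F) :
    ∃ a ∈ Hor x.1, (diffAlong (F := F) Q f x.1 a : F) = w ∧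
      ((a, adjoint (fderivWithin ℝ PH Q x.1 a) x.2) : E × E) ∈
        tangentSpaceOf (horizontalDualBundle Q PH) x := by
  obtain ⟨a, ha, haw⟩ := (h.bijOn_diffAlong hx.1).surjOn (Set.mem_univ w)
  exact ⟨a, ha, haw, h.lift_mem_tangentSpaceOf_dual hx (h.hor_le hx.1 ha)⟩

theorem fst_mem_vert_of_dualDiff_eq_zero (hx : x ∈ horizontalDualBundle Q PH)
    (hξ : ξ ∈ tangentSpaceOf (horizontalDualBundle Q PH) x) (h0 : dualDiff F Q f PH x ξ = 0) :
    ξ.1 ∈ verticalSpace Q f x.1 := by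
  refine (h.mem_vert_iff hx.1).2 ⟨((h.mem_tangentSpaceOf_dual_iff hx).1 hξ).1, ?_⟩
  exact (h.dualDiff_fst hx hξ).symm.trans (congrArg Prod.fst h0)

/-- A tangent vector in the kernel of the differential is `Ω`-orthogonal to all tangent vectors. -/
theorem inner_snd_of_dualDiff_eq_zero (hx : x ∈ horizontalDualBundle Q PH)
    (hξ : ξ ∈ tangentSpaceOf (horizontalDualBundle Q PH) x) (h0 : dualDiff F Q f PH x ξ = 0)
    (hΔ : Δ ∈ tangentSpaceOf Q x.1) :
    ⟪ξ.2, Δ⟫_ℝ = ⟪x.2, fderivWithin ℝ PH Q x.1 Δ ξ.1⟫_ℝ := by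
  have h1 := h.dualDiff_symplectic hx hξ (h.lift_mem_tangentSpaceOf_dual hx hΔ)
  rw [h0] at h1
  simp only [poincareForm, ContinuousLinearMap.adjoint_inner_right, Prod.fst_zero, Prod.snd_zero,
    map_zero, zero_apply, sub_zero] at h1
  rw [real_inner_comm x.2] at h1
  linarith

theorem ker_dualDiff (hx : x ∈ horizontalDualBundle Q PH) :
    {ξ : E × E | ξ ∈ tangentSpaceOf (horizontalDualBundle Q PH) x ∧ dualDiff F Q f PH x ξ = 0} =
      dualVertical Q f PH PV x := by
  ext ξ
  constructor
  · rintro ⟨hξ, h0⟩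
    have hV := h.fst_mem_vert_of_dualDiff_eq_zero hx hξ h0
    refine ⟨hV, -ξ.2, fun Δ hΔ => ?_, ?_⟩
    · rw [ContinuousLinearMap.adjoint_inner_right, real_inner_comm x.2,
        h.inner_fderivWithin_projV hx hΔ hV, ← h.inner_snd_of_dualDiff_eq_zero hx hξ h0 hΔ,
        inner_neg_right, real_inner_comm]
    · rw [map_neg, neg_neg]
      exact ((h.mem_tangentSpaceOf_dual_iff hx).1 hξ).2
  · rintro ⟨hV, Φ, hΦ, hξ2⟩
    have hT := h.vert_le hx.1 hV
    have hξ : ξ ∈ tangentSpaceOf (horizontalDualBundle Q PH) x := by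
      refine (h.mem_tangentSpaceOf_dual_iff hx).2 ⟨hT, ?_⟩
      conv_rhs => rw [hξ2]
      rw [map_add, map_neg, h.adjoint_projH_idem hx.1,
        h.adjoint_projH_adjoint_fderivWithin hx hT, add_zero]
      exact hξ2
    have h1 : (dualDiff F Q f PH x ξ).1 = 0 :=
      (h.dualDiff_fst hx hξ).trans ((h.mem_vert_iff hx.1).1 hV).2
    refine ⟨hξ, Prod.ext h1 ?_⟩
    ext w
    obtain ⟨a, ha, haw, hη⟩ := h.exists_lift hx w
    have haT := h.hor_le hx.1 ha
    have h2 := h.dualDiff_symplectic hx hξ hη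
    rw [h1, h.dualDiff_fst hx hη, map_zero, zero_sub] at h2
    change -((dualDiff F Q f PH x ξ).2 (diffAlong (F := F) Q f x.1 a)) = _ at h2
    rw [haw] at h2
    have h3 := hΦ a haT
    rw [ContinuousLinearMap.adjoint_inner_right, real_inner_comm x.2,
      h.inner_fderivWithin_projV hx haT hV] at h3
    rw [poincareForm, hξ2, inner_add_left, inner_neg_left, ContinuousLinearMap.adjoint_inner_left,
      ContinuousLinearMap.adjoint_inner_left, ContinuousLinearMap.adjoint_inner_right,
      h.projH_of_mem_hor hx.1 ha, h.inner_fderivWithin_projH_of_mem_hor hx hT ha,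
      real_inner_comm a Φ, real_inner_comm x.2, h3] at h2
    change (dualDiff F Q f PH x ξ).2 w = 0
    linarith

theorem dualHorizontal_subset (hx : x ∈ horizontalDualBundle Q PH) :
    dualHorizontal Q Hor PH x ⊆ tangentSpaceOf (horizontalDualBundle Q PH) x :=
  fun _ hξ => ((h.mem_dualHorizontal_iff hx).1 hξ).1

theorem bijOn_dualDiff (hx : x ∈ horizontalDualBundle Q PH) :
    Set.BijOn (dualDiff F Q f PH x) (dualHorizontal Q Hor PH x) Set.univ := by
  refine ⟨fun _ _ => Set.mem_univ _, ?_, ?_⟩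
  · intro ξ hξ η hη hξη
    rw [h.mem_dualHorizontal_iff hx] at hξ hη
    have h1 := Submodule.sub_mem _ hξ.1 hη.1
    have h0 : dualDiff F Q f PH x (ξ - η) = 0 := by rw [map_sub, hξη, sub_self]
    have h2 : (ξ - η).1 = 0 := h.eq_zero_of_mem hx.1 (Submodule.sub_mem _ hξ.2 hη.2)
      (h.fst_mem_vert_of_dualDiff_eq_zero hx h1 h0)
    have h3 : (ξ - η).2 = 0 := by
      have h4 := ((h.mem_tangentSpaceOf_dual_iff hx).1 h1).2
      rw [h2, map_zero, map_zero, zero_apply, add_zero] at h4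
      refine ext_inner_right ℝ fun e => ?_
      rw [h4, ContinuousLinearMap.adjoint_inner_left, inner_zero_left,
        h.inner_snd_of_dualDiff_eq_zero hx h1 h0 (h.hor_le hx.1 (h.projH_mem hx.1 e)), h2, map_zero,
        inner_zero_right]
    exact sub_eq_zero.1 (Prod.ext h2 h3)
  · rintro ⟨u, v⟩ -
    obtain ⟨a, ha, hau, hη₀⟩ := h.exists_lift hx u
    set η₀ : E × E := (a, adjoint (fderivWithin ℝ PH Q x.1 a) x.2) with hη₀def
    -- correct the covector component by a vector tangent to the fiber of `ℋ^*`
    let v' : F →L[ℝ] ℝ := v - (dualDiff F Q f PH x η₀).2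
    let c : E := horizontalPullback (F := F) Q f PH x.1 v'
    have hc : adjoint (PH x.1) c = c :=
      (h.mem_horizontalDual_iff hx.1).1 ((h.bijOn_horizontalPullback hx.1).mapsTo (Set.mem_univ v'))
    have hη₁ : ((0, c) : E × E) ∈ tangentSpaceOf (horizontalDualBundle Q PH) x := by
      refine (h.mem_tangentSpaceOf_dual_iff hx).2 ⟨zero_mem _, ?_⟩
      simp [hc]
    have h1 : (dualDiff F Q f PH x ((0, c) : E × E)).1 = 0 :=
      (h.dualDiff_fst hx hη₁).trans (map_zero (diffAlong (F := F) Q f x.1))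
    have h2 : (dualDiff F Q f PH x ((0, c) : E × E)).2 = v' := by
      ext w
      obtain ⟨b, hb, hbw, hη⟩ := h.exists_lift hx w
      have h3 := h.dualDiff_symplectic hx hη₁ hη
      have h4 : (dualDiff F Q f PH x (b, adjoint (fderivWithin ℝ PH Q x.1 b) x.2)).1 = w :=
        (h.dualDiff_fst hx hη).trans hbw
      have h5 : ⟪c, b⟫_ℝ = v' w := by
        have h6 := inner_horizontalPullback (Q := Q) (PH := PH) (q := x.1) (f := f) v' b
        rw [h.projH_of_mem_hor hx.1 hb] at h6
        exact h6.trans (congrArg v' hbw)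
      rw [h1, h4, map_zero, zero_sub, poincareForm, inner_zero_left, h5] at h3
      linarith
    refine ⟨η₀ + (0, c), (h.mem_dualHorizontal_iff hx).2 ⟨Submodule.add_mem _ hη₀ hη₁, ?_⟩, ?_⟩
    · simpa [hη₀def] using ha
    · rw [map_add]
      refine Prod.ext ?_ ?_
      · rw [Prod.fst_add, h1, add_zero, h.dualDiff_fst hx hη₀]
        exact hau
      · rw [Prod.snd_add, h2]
        exact add_sub_cancel (dualDiff F Q f PH x η₀).2 v

theorem isSmoothSubmersionOn_dualSubmersion :
    IsSmoothSubmersionOn (cotangentModel F) (dualSubmersion (F := F) Q f PH)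
      (horizontalDualBundle Q PH) := by
  refine ⟨h.contMDiffOn_dualSubmersion, fun x hx η => ?_⟩
  obtain ⟨ξ, hξ, hξη⟩ := (h.bijOn_dualDiff hx).surjOn (Set.mem_univ η)
  exact ⟨ξ, h.dualHorizontal_subset hx hξ, hξη⟩

end IsHorizontalSplitting

end DualVectors

/-! ### Hamilton vector fields -/

section Hamilton

variable {F B : Type*} [NormedAddCommGroup F] [NormedSpace ℝ F] [FiniteDimensional ℝ F]
  [TopologicalSpace B] [ChartedSpace F B] [IsManifold 𝓘(ℝ, F) ∞ B]


/-- The standard symplectic form of `F × F^*` is nondegenerate. -/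
theorem exists_forall_symplectic_eq_iff (l : F × (F →L[ℝ] ℝ) →L[ℝ] ℝ) :
    ∃ X : F × (F →L[ℝ] ℝ), ∀ Y : F × (F →L[ℝ] ℝ), (∀ η : F × (F →L[ℝ] ℝ),
      η.2 Y.1 - Y.2 η.1 = l η) ↔ Y = X := by
  let l₂ : Module.Dual ℝ (Module.Dual ℝ F) :=
    (l.comp (ContinuousLinearMap.inr ℝ F (F →L[ℝ] ℝ))).toLinearMap.comp
      (LinearMap.toContinuousLinearMap : (F →ₗ[ℝ] ℝ) ≃ₗ[ℝ] F →L[ℝ] ℝ).toLinearMap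
  let u : F := (Module.evalEquiv ℝ F).symm l₂
  have hu : ∀ w : F →L[ℝ] ℝ, w u = l (0, w) := by
    intro w
    have h1 : Module.evalEquiv ℝ F u = l₂ := LinearEquiv.apply_symm_apply _ _
    exact DFunLike.congr_fun h1 w.toLinearMap
  refine ⟨(u, -l.comp (ContinuousLinearMap.inl ℝ F (F →L[ℝ] ℝ))), fun Y => ⟨fun hY => ?_, ?_⟩⟩
  · refine Prod.ext ?_ ?_
    · refine (Module.evalEquiv ℝ F).injective (LinearMap.ext fun w => ?_)
      have h1 := hY (0, LinearMap.toContinuousLinearMap w)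
      rw [← hu] at h1
      simpa using h1
    · ext v
      have h1 := hY (v, 0)
      simp only [zero_apply, zero_sub] at h1
      change Y.2 v = -l (v, 0)
      linarith
  · rintro rfl η
    change η.2 u - -l (η.1, 0) = l η
    rw [hu, sub_neg_eq_add, ← map_add, Prod.mk_add_mk, zero_add, add_zero]

theorem exists_isHamiltonVector_iff (K : CotangentBundle F B → ℝ) (z : CotangentBundle F B) :
    ∃ X : TangentSpace (cotangentModel F) z, ∀ v, IsHamiltonVector K z v ↔ v = X := by
  obtain ⟨X, hX⟩ := exists_forall_symplectic_eq_iff (F := F)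
    (mfderiv (cotangentModel F) 𝓘(ℝ, ℝ) K z)
  refine ⟨X, fun v => Iff.trans ?_ (hX v)⟩
  exact forall_congr' fun η => Eq.congr_left (cotangentSymplectic_apply z v η)

variable {E : Type*} [NormedAddCommGroup E] [InnerProductSpace ℝ E] [FiniteDimensional ℝ E]
  {d : ℕ} {Q : Set E} {f : E → B} {P : E → E →L[ℝ] E} {Hor : E → Submodule ℝ E}
  {PH PV : E → E →L[ℝ] E} {x ξ η : E × E} {K : CotangentBundle F B → ℝ}

namespace IsHorizontalSplitting

variable (h : IsHorizontalSplitting F d Q f P Hor PH PV)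
include h

theorem contDiffOn_comp_dualSubmersion (hK : ContMDiff (cotangentModel F) 𝓘(ℝ, ℝ) ∞ K) :
    ContDiffOn ℝ ∞ (K ∘ dualSubmersion Q f PH) (horizontalDualBundle Q PH) :=
  contMDiffOn_iff_contDiffOn.1 (hK.comp_contMDiffOn h.contMDiffOn_dualSubmersion)

theorem fderivWithin_comp_dualSubmersion (hK : ContMDiff (cotangentModel F) 𝓘(ℝ, ℝ) ∞ K)
    (hx : x ∈ horizontalDualBundle Q PH)
    (hξ : ξ ∈ tangentSpaceOf (horizontalDualBundle Q PH) x) :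
    fderivWithin ℝ (K ∘ dualSubmersion Q f PH) (horizontalDualBundle Q PH) x ξ =
      mfderiv (cotangentModel F) 𝓘(ℝ, ℝ) K (dualSubmersion Q f PH x)
        (dualSubmersionDiff (F := F) Q f PH x ξ) := by
  obtain ⟨⟨U, ρ, hqU, hρ⟩, -⟩ := h.submanifold.exists_isSmoothRetraction hx.1
  have hxU : x ∈ horizontalDualBundle Q PH ∩ U ×ˢ Set.univ := ⟨hx, hqU, Set.mem_univ _⟩
  have hR := h.isSmoothRetraction_dual hρ
  have h1 : HasFDerivWithinAt (K ∘ dualSubmersion Q f PH)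
      (fderivWithin ℝ (K ∘ dualSubmersion Q f PH) (horizontalDualBundle Q PH) x)
      (horizontalDualBundle Q PH) x :=
    ((h.contDiffOn_comp_dualSubmersion hK x hx).differentiableWithinAt (by simp)).hasFDerivWithinAt
  have h2 := ((hK.mdifferentiable (by simp)) (dualSubmersion Q f PH x)).hasMFDerivAt
  have h3 := (HasMFDerivAt.comp_hasMFDerivWithinAt x h2
    (h.hasMFDerivWithinAt_dualSubmersion hx)).hasFDerivWithinAt
  exact (hR.hasFDerivWithinAt_apply hxU h1 hξ).trans
    (hR.hasFDerivWithinAt_apply hxU h3 hξ).symm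

theorem isDualHamiltonian_comp (hK : ContMDiff (cotangentModel F) 𝓘(ℝ, ℝ) ∞ K) :
    IsDualHamiltonian Q f PH PV (K ∘ dualSubmersion Q f PH) := by
  refine ⟨h.contDiffOn_comp_dualSubmersion hK, fun x hx ξ hξ => ?_⟩
  rw [← h.ker_dualDiff hx] at hξ
  rw [h.fderivWithin_comp_dualSubmersion hK hx hξ.1]
  have h1 : dualSubmersionDiff (F := F) Q f PH x ξ = 0 := hξ.2
  rw [h1]
  exact map_zero (mfderiv (cotangentModel F) 𝓘(ℝ, ℝ) K (dualSubmersion Q f PH x))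

/-- A horizontal vector is the Hamilton vector of `K ∘ f_{ℋ^*}` exactly when its image is the
Hamilton vector of `K`, as `f_{ℋ^*}` is presymplectic and its differential maps the horizontal
vectors onto the tangent space. -/
theorem isDualHamiltonVector_iff (hK : ContMDiff (cotangentModel F) 𝓘(ℝ, ℝ) ∞ K)
    (hx : x ∈ horizontalDualBundle Q PH) (hξ : ξ ∈ dualHorizontal Q Hor PH x) :
    IsDualHamiltonVector Q Hor PH (K ∘ dualSubmersion Q f PH) x ξ ↔
      IsHamiltonVector K (dualSubmersion Q f PH x) (dualSubmersionDiff (F := F) Q f PH x ξ) := by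
  have hT := h.dualHorizontal_subset hx
  constructor
  · rintro ⟨-, h1⟩ η
    obtain ⟨ζ, hζ, rfl⟩ := (h.bijOn_dualDiff hx).surjOn (Set.mem_univ η)
    refine (h.cotangentSymplectic_dualSubmersionDiff hx (hT hξ) (hT hζ)).trans ?_
    exact (h1 ζ hζ).trans (h.fderivWithin_comp_dualSubmersion hK hx (hT hζ))
  · intro h1
    refine ⟨hξ, fun ζ hζ => ?_⟩
    rw [← h.cotangentSymplectic_dualSubmersionDiff hx (hT hξ) (hT hζ),
      h.fderivWithin_comp_dualSubmersion hK hx (hT hζ)]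
    exact h1 _

end IsHorizontalSplitting

end Hamilton

end

theorem mainTheorem9
    {E : Type*} [NormedAddCommGroup E] [InnerProductSpace ℝ E] [FiniteDimensional ℝ E]
    {F : Type*} [NormedAddCommGroup F] [NormedSpace ℝ F] [FiniteDimensional ℝ F]
    {B : Type*} [TopologicalSpace B] [ChartedSpace F B] [IsManifold 𝓘(ℝ, F) ∞ B]
    -- the embedded manifold `Q` and the submersion `f : Q → B`
    (d : ℕ) (Q : Set E) (hQ : IsEmbeddedSubmanifold d Q)
    (f : E → B) (hf : IsSmoothSubmersionOn 𝓘(ℝ, F) f Q)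
    -- the projection function onto `TQ`
    (P : E → E →L[ℝ] E) (hP : ContDiffOn ℝ ∞ P Q)
    (hP_idem : ∀ q ∈ Q, (P q).comp (P q) = P q)
    (hP_range : ∀ q ∈ Q, LinearMap.range (P q).toLinearMap = tangentSpaceOf Q q)
    -- the horizontal bundle, a complement in `TQ` of the vertical bundle
    (Hor : E → Submodule ℝ E) (hHor : IsSmoothSubbundle Q Hor)
    (hinf : ∀ q ∈ Q, Hor q ⊓ verticalSpace Q f q = ⊥)
    (hsup : ∀ q ∈ Q, Hor q ⊔ verticalSpace Q f q = tangentSpaceOf Q q)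
    -- the corresponding decomposition of the projection function
    (PH PV : E → E →L[ℝ] E)
    (hdec : ∀ q ∈ Q, ∀ e, PH q e ∈ Hor q ∧ PV q e ∈ verticalSpace Q f q ∧
      PH q e + PV q e = P q e) :
    -- the fibers are submanifolds of dimension `dim Q - dim B`, and their tangent spaces form a
    -- subbundle of `TQ`
    (Q.Nonempty → Module.finrank ℝ F ≤ d) ∧
    (∀ b : B, IsEmbeddedSubmanifold (d - Module.finrank ℝ F) (Q ∩ f ⁻¹' {b})) ∧
    (∀ q ∈ Q, verticalSpace Q f q ≤ tangentSpaceOf Q q) ∧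
    IsSmoothSubbundle Q (verticalSpace Q f) ∧
    -- `f'(q)` is bijective from the horizontal space onto the tangent space of `B`, and
    -- `PH(q)ᵗ f'(q)^*` is bijective from the cotangent space of `B` onto the fiber of `ℋ^*`
    (∀ q ∈ Q, Set.BijOn (diffAlong (F := F) Q f q) (Hor q) Set.univ) ∧
    (∀ q ∈ Q, Set.BijOn (horizontalPullback (F := F) Q f PH q) Set.univ (horizontalDual PH q)) ∧
    -- `f_{ℋ^*}` is a smooth submersion from the manifold `ℋ^*` onto the part of `T^* B` over the
    -- image of `f`, which is all of `T^* B` when `f` is onto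
    IsEmbeddedSubmanifold (d + Module.finrank ℝ F) (horizontalDualBundle Q PH) ∧
    IsSmoothSubmersionOn (cotangentModel F) (dualSubmersion (F := F) Q f PH)
      (horizontalDualBundle Q PH) ∧
    dualSubmersion (F := F) Q f PH '' horizontalDualBundle Q PH =
      Bundle.TotalSpace.proj ⁻¹' (f '' Q) ∧
    (Set.SurjOn f Q Set.univ →
      Set.SurjOn (dualSubmersion (F := F) Q f PH) (horizontalDualBundle Q PH) Set.univ) ∧
    -- `f_{ℋ^*}` is presymplectic
    (∀ x ∈ horizontalDualBundle Q PH,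
      ∀ ξ ∈ tangentSpaceOf (horizontalDualBundle Q PH) x,
      ∀ η ∈ tangentSpaceOf (horizontalDualBundle Q PH) x,
      cotangentSymplectic (dualSubmersion (F := F) Q f PH x)
        (dualSubmersionDiff Q f PH x ξ) (dualSubmersionDiff Q f PH x η) = poincareForm ξ η) ∧
    -- the kernel of its differential is the space of `ℋ^*`-vertical vectors
    (∀ x ∈ horizontalDualBundle Q PH,
      {ξ : E × E | ξ ∈ tangentSpaceOf (horizontalDualBundle Q PH) x ∧
        dualSubmersionDiff (F := F) Q f PH x ξ = 0} = dualVertical Q f PH PV x) ∧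
    -- the `ℋ^*`-horizontal vectors are mapped bijectively onto the tangent space of `T^* B`
    (∀ x ∈ horizontalDualBundle Q PH,
      dualHorizontal Q Hor PH x ⊆ tangentSpaceOf (horizontalDualBundle Q PH) x ∧
      Set.BijOn (dualSubmersionDiff (F := F) Q f PH x) (dualHorizontal Q Hor PH x) Set.univ) ∧
    -- lift of Hamilton vector fields and flows
    ∀ K : CotangentBundle F B → ℝ, ContMDiff (cotangentModel F) 𝓘(ℝ, ℝ) ∞ K →
      IsDualHamiltonian Q f PH PV (K ∘ dualSubmersion Q f PH) ∧
      ∃ (X : ∀ z : CotangentBundle F B, TangentSpace (cotangentModel F) z) (Z : E × E → E × E),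
        -- `X` is the Hamilton vector field of `K`
        (∀ z v, IsHamiltonVector K z v ↔ v = X z) ∧
        -- `Z` is the `ℋ^*`-Hamilton vector field of `K ∘ f_{ℋ^*}`
        (∀ x ∈ horizontalDualBundle Q PH, ∀ ζ,
          IsDualHamiltonVector Q Hor PH (K ∘ dualSubmersion Q f PH) x ζ ↔ ζ = Z x) ∧
        -- `Z` is mapped to `X`
        (∀ x ∈ horizontalDualBundle Q PH,
          dualSubmersionDiff (F := F) Q f PH x (Z x) = X (dualSubmersion Q f PH x)) ∧
        -- solution curves of `Z` in `ℋ^*` are mapped to solution curves of `X`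
        (∀ (J : Set ℝ) (γ : ℝ → E × E),
          (∀ t ∈ J, γ t ∈ horizontalDualBundle Q PH ∧ HasDerivWithinAt γ (Z (γ t)) J t) →
          IsMIntegralCurveOn (I := cotangentModel F) (dualSubmersion (F := F) Q f PH ∘ γ) X J) := by
  have h : IsHorizontalSplitting F d Q f P Hor PH PV :=
    ⟨hQ, hf, hP, hP_idem, hP_range, hHor, hinf, hsup, hdec⟩
  refine ⟨?_, isEmbeddedSubmanifold_fiber hQ hf, fun q hq => h.vert_le hq, h.isSmoothSubbundle_vert,
    fun q hq => h.bijOn_diffAlong hq, fun q hq => h.bijOn_horizontalPullback hq,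
    h.isEmbeddedSubmanifold_dual, h.isSmoothSubmersionOn_dualSubmersion, h.image_dualSubmersion,
    ?_, fun x hx ξ hξ η hη => h.cotangentSymplectic_dualSubmersionDiff hx hξ hη,
    fun x hx => h.ker_dualDiff hx,
    fun x hx => ⟨h.dualHorizontal_subset hx, h.bijOn_dualDiff hx⟩, fun K hK => ?_⟩
  · rintro ⟨q, hq⟩
    have := finrank_verticalSpace_add hQ hf hq
    omega
  · intro hsurj z _
    have hz : z ∈ Bundle.TotalSpace.proj ⁻¹' (f '' Q) := hsurj (Set.mem_univ z.1)
    rwa [← h.image_dualSubmersion] at hz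
  · refine ⟨h.isDualHamiltonian_comp hK, ?_⟩
    choose X hX using exists_isHamiltonVector_iff (F := F) K
    have hZ : ∀ x : E × E, ∃ ζ : E × E, x ∈ horizontalDualBundle Q PH →
        ζ ∈ dualHorizontal Q Hor PH x ∧
          dualSubmersionDiff (F := F) Q f PH x ζ = X (dualSubmersion Q f PH x) := by
      intro x
      by_cases hx : x ∈ horizontalDualBundle Q PH
      · obtain ⟨ζ, hζ, hζX⟩ :=
          (h.bijOn_dualDiff hx).surjOn (Set.mem_univ (X (dualSubmersion Q f PH x)))
        exact ⟨ζ, fun _ => ⟨hζ, hζX⟩⟩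
      · exact ⟨0, fun hx' => absurd hx' hx⟩
    choose Z hZ using hZ
    refine ⟨X, Z, hX, fun x hx ζ => ⟨fun hζ => ?_, ?_⟩, fun x hx => (hZ x hx).2, fun J γ hγ t ht => ?_⟩
    · refine (h.bijOn_dualDiff hx).injOn hζ.1 (hZ x hx).1 ?_
      exact ((hX _ _).1 ((h.isDualHamiltonVector_iff hK hx hζ.1).1 hζ)).trans (hZ x hx).2.symm
    · rintro rfl
      exact (h.isDualHamiltonVector_iff hK hx (hZ x hx).1).2 ((hX _ _).2 (hZ x hx).2)
    · have hγt := (hγ t ht).2.hasFDerivWithinAt.hasMFDerivWithinAt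
      have hD : ∀ r : ℝ, dualSubmersionDiff (F := F) Q f PH (γ t) (r • Z (γ t)) =
          r • X (dualSubmersion Q f PH (γ t)) := fun r => by
        rw [← (hZ _ (hγ t ht).1).2]
        exact map_smul (dualSubmersionDiff (F := F) Q f PH (γ t)) r (Z (γ t))
      exact HasMFDerivWithinAt.congr_mfderiv (HasMFDerivWithinAt.comp t
        (h.hasMFDerivWithinAt_dualSubmersion (hγ t ht).1) hγt fun s hs => (hγ s hs).1)
        (ContinuousLinearMap.ext hD)
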